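/- For a Borel probability measure $\mu$ on $\mathbb{R}^d$ let $$\Lambda^*_\mu(x)=\sup_{\xi\in\mathbb{R}^d}\Big(\langle x,\xi\rangle-\log\int_{\mathbb{R}^d} e^{\langle \xi,z\rangle}\,d\mu(z)\Big)\in[0,+\infty],\qquad x\in\mathbb{R}^d,$$ denote its Cramér transform, and write $\Lambda^*_X=\Lambda^*_\mu$ if $X$ is a random vector with law $\mu$ (with $e^{-\infty}=0$). A real random variable with law $\nu$ is called log-concave if $\nu((1-\lambda)A+\lambda B)\ge \nu(A)^{1-\lambda}\nu(B)^{\lambda}$ for all Borel sets $A,B\subset\mathbb{R}$ and all $\lambda\in(0,1)$, and non-degenerate if $\nu(\{a\})<1$ for every $a\in\mathbb{R}$. **Theorem.** Let $X=(X_1,\ldots,X_n)$ be a random vector in $\mathbb{R}^n$ whose components $X_1,\dots,X_n$ are independent, symmetric (that is, $-X_i$ has the same law as $X_i$), log-concave and non-degenerate. Then $$\mathbb{E}\,e^{-\Lambda^*_X(X)}\le c_{\exp}^{\,n},\qquad\text{where } c_{\exp}=\mathbb{E}\,e^{-\Lambda^*_Y(Y)}$$ and $Y$ is a standard double exponential random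 variable, i.e. one with density $\tfrac12 e^{-|x|}$ on $\mathbb{R}$. Moreover $0.787\le c_{\exp}<0.788$. -/

import Mathlib

open MeasureTheory ProbabilityTheory
open scoped ENNReal Pointwise

noncomputable section

namespace OneShot

/-- A measure `μ` on a real vector space is log-concave if
`μ((1-t)A + tB) ≥ μ(A)^(1-t) μ(B)^t` for all measurable `A`, `B` and all `t ∈ (0,1)`.
(If the Minkowski sum is not measurable, the left side is its outer measure; for Borel sets of
`ℝ^d` the sum is analytic, so this is its measure for the completion of `μ`.) -/
def IsLogConcave {E : Type*} [AddCommGroup E] [Module ℝ E] [MeasurableSpace E]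
    (μ : Measure E) : Prop :=
  ∀ A B : Set E, MeasurableSet A → MeasurableSet B → ∀ t : ℝ, 0 < t → t < 1 →
    μ A ^ (1 - t) * μ B ^ t ≤ μ ((1 - t) • A + t • B)

section Cramer

variable {E : Type*} [NormedAddCommGroup E] [InnerProductSpace ℝ E] [MeasurableSpace E]

/-- The logarithmic Laplace transform `Λ_μ(ξ) = log ∫ exp ⟨ξ, z⟩ dμ(z)`, with value `+∞` where the
integral diverges. -/
def logLaplace (μ : Measure E) (ξ : E) : EReal :=
  ENNReal.log (∫⁻ z, ENNReal.ofReal (Real.exp (inner ℝ ξ z)) ∂μ)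

/-- The Cramér transform `Λ*_μ(x) = sup_ξ (⟨x, ξ⟩ - Λ_μ(ξ))`, with values in `[-∞, +∞]`. -/
def cramer (μ : Measure E) (x : E) : EReal :=
  ⨆ ξ : E, ((inner ℝ x ξ : ℝ) : EReal) - logLaplace μ ξ

/-- `E exp(-Λ*_X(X))` for a random vector `X` with law `μ`; here `exp(-∞) = 0`. -/
def expNegCramer (μ : Measure E) : ℝ≥0∞ :=
  ∫⁻ x, EReal.exp (-cramer μ x) ∂μ

end Cramer

/-- The standard double exponential distribution on `ℝ`, with density `exp(-|x|) / 2`. -/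
def doubleExponential : Measure ℝ :=
  volume.withDensity fun x => ENNReal.ofReal (1 / 2 * Real.exp (-|x|))

/-- The constant `c_exp = E exp(-Λ*_Y(Y))` for a standard double exponential `Y`. -/
def cExp : ℝ≥0∞ := expNegCramer doubleExponential

end OneShot

end

open MeasureTheory ProbabilityTheory
open scoped ENNReal Pointwise

noncomputable section

namespace OneShot

open Set Filter Topology

/-! Everything reduces to one dimension: by independence the Laplace transform factors, so tilts
chosen coordinate by coordinate bound the Cramér transform of `X` below by a sum of one-dimensional
bounds, and the expectation of the resulting product splits.

In dimension one let T(z) = ν{|x| ≥ z} and y = -log T(|x|), so that a double exponential variable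
has the same tail at y as ν has at |x|. The heart is the pointwise bound Λ*_ν(x) ≥ `expRate y`,
where `expRate` is the Cramér transform of the double exponential law (`exists_lintegral_exp_le`).
Since ν is atomless, T(|x|) is uniform on [0,1] under ν (`map_tail_abs`), so the expectation of
exp(-`expRate y`) is the same for every such ν, namely `cExp`.

For the pointwise bound, T is log-concave, hence lies below an exponential of some rate c touching
it at |x|. T is also convex on [0,∞), because a symmetric log-concave law is unimodal, and T(0) = 1.
So T lies below the profile that follows the line from (0,1) tangent to that exponential up to the
contact point s, and the exponential afterwards. The Laplace transform of this profile is explicit.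
At the tilt cη, with η the optimal double exponential tilt at y, a one-variable inequality
(`cosh_add_sinh_div_le`) turns it into the required bound.

The constant equals 3/4 + e·E₁(1)/16, with E₁ the exponential integral; it is enclosed by replacing
e^w E₁(w) with two convergents of its continued fraction. -/

/-! ### Supporting exponentials and chords -/

/-- A nonnegative continuous log-concave function on `[0, ∞)` lies below an exponential touching it
at a given interior point of its support. -/
theorem exists_exp_tangent {T : ℝ → ℝ} (hT0 : ∀ z, 0 ≤ T z) (hT : Continuous T)
    (hlog : ∀ a b : ℝ, 0 ≤ a → 0 ≤ b → ∀ t : ℝ, 0 < t → t < 1 →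
      T a ^ (1 - t) * T b ^ t ≤ T ((1 - t) * a + t * b))
    (hzero : 0 < T 0) {x : ℝ} (hx : 0 < x) (hTx : 0 < T x) :
    ∃ c : ℝ, ∀ z, 0 ≤ z → T z ≤ T x * Real.exp (-(c * (z - x))) := by
  -- One point of positivity to the right of x is enough to bound the left secant slopes of log T.
  obtain ⟨b, hxb, hTb⟩ : ∃ b, x < b ∧ 0 < T b := by
    have h1 : ∀ᶠ b in 𝓝[>] x, 0 < T b :=
      (hT.continuousAt.eventually (lt_mem_nhds hTx)).filter_mono nhdsWithin_le_nhds
    obtain ⟨b, hb1, hb2⟩ := (h1.and self_mem_nhdsWithin).exists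
    exact ⟨b, hb2, hb1⟩
  have key : ∀ z w, 0 ≤ z → z < x → x < w → 0 < T z → 0 < T w →
      (Real.log (T z) - Real.log (T x)) / (x - z) ≤ (Real.log (T x) - Real.log (T w)) / (w - x) := by
    intro z w hz hzx hxw hTz hTw
    have hwz : 0 < w - z := by linarith
    have h := hlog z w hz (by linarith) ((x - z) / (w - z)) (div_pos (by linarith) hwz)
      ((div_lt_one hwz).2 (by linarith))
    have e : (1 - (x - z) / (w - z)) * z + (x - z) / (w - z) * w = x := by
      field_simp; ring
    rw [e] at h
    have h2 := Real.log_le_log (by positivity) h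
    rw [Real.log_mul (by positivity) (by positivity), Real.log_rpow hTz, Real.log_rpow hTw] at h2
    rw [div_le_div_iff₀ (by linarith) (by linarith)]
    have h3 := mul_le_mul_of_nonneg_left h2 hwz.le
    have e3 : (w - z) * ((1 - (x - z) / (w - z)) * Real.log (T z)
        + (x - z) / (w - z) * Real.log (T w))
        = (w - x) * Real.log (T z) + (x - z) * Real.log (T w) := by
      field_simp; ring
    rw [e3] at h3
    linarith
  -- Negated secant slopes of log T from the left of x; their supremum is a supporting slope and
  -- serves as c.
  set A : Set ℝ := {a | ∃ z, 0 ≤ z ∧ z < x ∧ 0 < T z ∧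
    a = (Real.log (T z) - Real.log (T x)) / (x - z)}
  have hAne : A.Nonempty := ⟨_, 0, le_rfl, hx, hzero, rfl⟩
  have hub : ∀ w, x < w → 0 < T w → (Real.log (T x) - Real.log (T w)) / (w - x) ∈ upperBounds A := by
    rintro w hw hTw a ⟨z, hz, hzx, hTz, rfl⟩
    exact key z w hz hzx hw hTz hTw
  refine ⟨sSup A, fun z hz => ?_⟩
  rcases (hT0 z).eq_or_lt with h0 | hpos
  · rw [← h0]; positivity
  have hmain : Real.log (T z) ≤ Real.log (T x) + -(sSup A * (z - x)) := by
    rcases lt_trichotomy z x with h | h | h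
    · have := le_csSup ⟨_, hub b hxb hTb⟩ (show _ ∈ A from ⟨z, hz, h, hpos, rfl⟩)
      rw [div_le_iff₀ (by linarith)] at this
      linarith
    · subst h; simp
    · have := csSup_le hAne (hub z h hpos)
      rw [le_div_iff₀ (by linarith)] at this
      linarith
  rw [← Real.exp_log hpos]
  calc Real.exp (Real.log (T z)) ≤ Real.exp (Real.log (T x) + -(sSup A * (z - x))) :=
        Real.exp_le_exp.2 hmain
    _ = _ := by rw [Real.exp_add, Real.exp_log hTx]

/-- A continuous midpoint convex function on `[0, ∞)` lies below its chords from the origin. -/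
theorem le_chord_of_midpoint {T : ℝ → ℝ} (hT : Continuous T)
    (hmid : ∀ a h : ℝ, 0 ≤ a → 0 ≤ h → 2 * T (a + h) ≤ T a + T (a + 2 * h))
    {s k m : ℝ} (h0 : T 0 ≤ m) (hs : T s ≤ m - k * s) {z : ℝ} (hz : z ∈ Icc 0 s) :
    T z ≤ m - k * z := by
  by_contra hcon
  push Not at hcon
  set D : ℝ → ℝ := fun z => T z - (m - k * z) with hD
  have hDc : Continuous D := by fun_prop
  obtain ⟨p, hp, hpmax⟩ := isCompact_Icc.exists_isMaxOn ⟨z, hz⟩ hDc.continuousOn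
  have hDp : 0 < D p := lt_of_lt_of_le (by simp only [hD]; linarith) (hpmax hz)
  -- At the leftmost maximiser q of the excess D, the value at q - r is strictly smaller and the
  -- value at q + r is no larger, which contradicts midpoint convexity at q.
  set K : Set ℝ := Icc 0 s ∩ D ⁻¹' {D p}
  have hK : IsCompact K := isCompact_Icc.inter_right (isClosed_singleton.preimage hDc)
  obtain ⟨q, hq, hqmin⟩ := hK.exists_isMinOn ⟨p, hp, rfl⟩ continuousOn_id
  have hDq : D q = D p := hq.2
  have hq0 : 0 < q := by
    rcases hq.1.1.eq_or_lt with h | h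
    · have : D q ≤ 0 := by rw [← h]; simp only [hD]; linarith
      linarith
    · exact h
  have hqs : q < s := by
    rcases hq.1.2.eq_or_lt with h | h
    · have : D q ≤ 0 := by rw [h]; simp only [hD]; linarith
      linarith
    · exact h
  set r := min q (s - q)
  have hr : 0 < r := lt_min hq0 (by linarith)
  have hr1 : r ≤ q := min_le_left _ _
  have hr2 : r ≤ s - q := min_le_right _ _
  have h1 := hmid (q - r) r (by linarith) hr.le
  have e1 : q - r + r = q := by ring
  have e2 : q - r + 2 * r = q + r := by ring
  rw [e1, e2] at h1
  have h2 : D (q + r) ≤ D p := hpmax (show q + r ∈ Icc 0 s from ⟨by linarith, by linarith⟩)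
  have hm : q - r ∈ Icc 0 s := ⟨by linarith, by linarith⟩
  have h3 : D (q - r) < D p := by
    refine lt_of_le_of_ne (hpmax hm) fun h => ?_
    have : q ≤ q - r := hqmin (show q - r ∈ K from ⟨hm, h⟩)
    linarith
  simp only [hD] at h2 h3 hDq
  linarith

/-! ### Exponential moments of the affine-then-exponential tail -/

/-- Locates the contact point of the line through (0,1) tangent to a given exponential: with σ = cs,
tangency at s reads (1 + σ)e^{-σ} = r, where 1/r is the value of the exponential at 0. -/
theorem exists_one_add_mul_exp_neg_eq {r : ℝ} (hr0 : 0 < r) (hr1 : r ≤ 1) :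
    ∃ σ : ℝ, 0 ≤ σ ∧ (1 + σ) * Real.exp (-σ) = r := by
  have hlim : Tendsto (fun σ : ℝ => (1 + σ) * Real.exp (-σ)) atTop (𝓝 0) := by
    have h1 := Real.tendsto_pow_mul_exp_neg_atTop_nhds_zero 1
    have h0 := Real.tendsto_pow_mul_exp_neg_atTop_nhds_zero 0
    simpa [add_mul] using h0.add h1
  obtain ⟨M, hM, hM0⟩ := ((hlim.eventually (gt_mem_nhds hr0)).and (eventually_ge_atTop 0)).exists
  obtain ⟨σ, hσ, h⟩ := intermediate_value_Icc' hM0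
    (f := fun σ : ℝ => (1 + σ) * Real.exp (-σ)) (by fun_prop) ⟨hM.le, by simpa using hr1⟩
  exact ⟨σ, hσ.1, h⟩

/-- After division by e^{ησ} and multiplication by 1 + σ, the claim is g(0) ≤ g(σ) for the function
g below. Up to the factor 1 - η its derivative is (1+s)^{-η} - e^{-2ηs}, nonnegative since log(1+s)
≤ s ≤ 2s. -/
theorem cosh_add_sinh_div_le {η σ : ℝ} (hη0 : 0 < η) (hη1 : η < 1) (hσ : 0 ≤ σ) :
    (Real.cosh (η * σ) + Real.sinh (η * σ) / η) / (1 + σ)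
      ≤ Real.exp (η * σ) * (1 + σ) ^ (-η) := by
  set g : ℝ → ℝ := fun s => (1 + s) ^ (1 - η) + (1 / η - 1) / 2 * Real.exp (-2 * η * s) with hg
  have hd : ∀ s, 0 ≤ s → HasDerivAt g ((1 - η) * (1 + s) ^ (-η)
      + (1 / η - 1) / 2 * (Real.exp (-2 * η * s) * (-2 * η))) s := by
    intro s hs
    have h1 : HasDerivAt (fun s : ℝ => 1 + s) 1 s := by
      simpa using (hasDerivAt_id s).const_add 1
    have h2 := h1.rpow_const (p := 1 - η) (Or.inl (by positivity))
    have h3 : HasDerivAt (fun s : ℝ => -2 * η * s) (-2 * η) s := by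
      simpa using (hasDerivAt_id s).const_mul (-2 * η)
    have h4 := h2.add (h3.exp.const_mul ((1 / η - 1) / 2))
    have e : (1 : ℝ) - η - 1 = -η := by ring
    rw [e, one_mul] at h4
    exact h4
  have hmono : MonotoneOn g (Ici 0) := by
    refine monotoneOn_of_deriv_nonneg (convex_Ici 0)
      (fun s hs => (hd s hs).continuousAt.continuousWithinAt)
      (fun s hs => (hd s (interior_subset hs)).differentiableAt.differentiableWithinAt) ?_
    intro s hs
    have hs0 : 0 ≤ s := interior_subset hs
    rw [(hd s hs0).deriv]
    have e : (1 / η - 1) / 2 * (Real.exp (-2 * η * s) * (-2 * η))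
        = -((1 - η) * Real.exp (-2 * η * s)) := by
      field_simp
    have hle : Real.exp (-2 * η * s) ≤ (1 + s) ^ (-η) := by
      rw [Real.rpow_def_of_pos (by positivity)]
      apply Real.exp_le_exp.2
      have := Real.log_le_sub_one_of_pos (show 0 < 1 + s by positivity)
      nlinarith [mul_nonneg hη0.le hs0]
    rw [e]
    nlinarith
  have h := hmono (mem_Ici.2 le_rfl) hσ hσ
  simp only [hg] at h
  norm_num at h
  have e1 : (1 + σ) ^ (1 - η) = (1 + σ) * (1 + σ) ^ (-η) := by
    rw [sub_eq_add_neg, Real.rpow_add (by positivity), Real.rpow_one]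
  rw [e1] at h
  have e2 : Real.cosh (η * σ) + Real.sinh (η * σ) / η
      = Real.exp (η * σ) * ((1 + 1 / η) / 2 - (1 / η - 1) / 2 * Real.exp (-2 * η * σ)) := by
    have : Real.exp (-2 * η * σ) = Real.exp (-(η * σ)) * Real.exp (-(η * σ)) := by
      rw [← Real.exp_add]; ring_nf
    rw [Real.cosh_eq, Real.sinh_eq, this]
    have h1 : Real.exp (η * σ) * Real.exp (-(η * σ)) = 1 := by rw [← Real.exp_add]; simp
    linear_combination (1 / η - 1) / 2 * Real.exp (-(η * σ)) * h1
  rw [e2, div_le_iff₀ (by positivity), mul_assoc (Real.exp (η * σ)) ((1 + σ) ^ (-η))]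
  refine mul_le_mul_of_nonneg_left ?_ (Real.exp_pos _).le
  have e3 : (1 : ℝ) / η = η⁻¹ := one_div _
  rw [e3]
  simp only [neg_mul] at *
  linarith

theorem setLIntegral_Ioc_sinh_mul_affine {ξ k s : ℝ} (hξ : 0 < ξ) (hs : 0 ≤ s) (hks : k * s ≤ 1)
    (hk : 0 ≤ k) :
    ∫⁻ t in Ioc 0 s, ENNReal.ofReal ((1 - k * t) * (ξ * Real.sinh (ξ * t)))
      = ENNReal.ofReal ((1 - k * s) * Real.cosh (ξ * s) + k / ξ * Real.sinh (ξ * s) - 1) := by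
  have hc : Continuous fun t => (1 - k * t) * (ξ * Real.sinh (ξ * t)) := by
    have := Real.continuous_sinh
    fun_prop
  rw [← ofReal_integral_eq_lintegral_ofReal, ← intervalIntegral.integral_of_le hs]
  · congr 1
    rw [intervalIntegral.integral_eq_sub_of_hasDerivAt
      (f := fun t => (1 - k * t) * Real.cosh (ξ * t) + k / ξ * Real.sinh (ξ * t))]
    · simp
    · intro t _
      have h1 : HasDerivAt (fun t : ℝ => ξ * t) ξ t := by
        simpa using (hasDerivAt_id t).const_mul ξ
      have h2 : HasDerivAt (fun t : ℝ => 1 - k * t) (-k) t := by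
        simpa using ((hasDerivAt_id t).const_mul k).const_sub 1
      have h3 := (h2.mul h1.cosh).add (h1.sinh.const_mul (k / ξ))
      refine HasDerivAt.congr_deriv h3 ?_
      field_simp
      ring
    · exact hc.intervalIntegrable _ _
  · exact (hc.integrableOn_Icc (a := 0) (b := s)).mono_set Ioc_subset_Icc_self
  · refine (ae_restrict_iff' measurableSet_Ioc).2 (ae_of_all _ fun t ht => ?_)
    have : 0 ≤ Real.sinh (ξ * t) := Real.sinh_nonneg_iff.2 (mul_nonneg hξ.le ht.1.le)
    have h2 : k * t ≤ 1 := (mul_le_mul_of_nonneg_left ht.2 hk).trans hks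
    have : 0 ≤ 1 - k * t := by linarith
    simp only [Pi.zero_apply]
    positivity

theorem setLIntegral_Ioi_sinh_mul_exp {ξ c s : ℝ} (hξ : 0 < ξ) (hξc : ξ < c) (hs : 0 ≤ s) :
    ∫⁻ t in Ioi s, ENNReal.ofReal (Real.exp (-(c * (t - s))) * (ξ * Real.sinh (ξ * t)))
      = ENNReal.ofReal
        (ξ * (ξ * Real.cosh (ξ * s) + c * Real.sinh (ξ * s)) / (c ^ 2 - ξ ^ 2)) := by
  set g : ℝ → ℝ := fun t => -(Real.exp (-(c * (t - s)))
    * (ξ * (ξ * Real.cosh (ξ * t) + c * Real.sinh (ξ * t)) / (c ^ 2 - ξ ^ 2))) with hg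
  have hne : c ^ 2 - ξ ^ 2 ≠ 0 := by nlinarith
  have hd : ∀ t ∈ Ici s, HasDerivAt g
      (Real.exp (-(c * (t - s))) * (ξ * Real.sinh (ξ * t))) t := by
    intro t _
    have h1 : HasDerivAt (fun t : ℝ => ξ * t) ξ t := by
      simpa using (hasDerivAt_id t).const_mul ξ
    have h2 : HasDerivAt (fun t : ℝ => -(c * (t - s))) (-c) t := by
      simpa using (((hasDerivAt_id t).sub_const s).const_mul c).fun_neg
    have h3 := (h2.exp.mul ((((h1.cosh.const_mul ξ).add (h1.sinh.const_mul c)).const_mul ξ).div_const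
      (c ^ 2 - ξ ^ 2))).neg
    refine HasDerivAt.congr_deriv h3 ?_
    simp only [Pi.add_apply]
    field_simp
    ring
  have hpos : ∀ t ∈ Ioi s, 0 ≤ Real.exp (-(c * (t - s))) * (ξ * Real.sinh (ξ * t)) := by
    intro t ht
    have : 0 ≤ Real.sinh (ξ * t) :=
      Real.sinh_nonneg_iff.2 (mul_nonneg hξ.le (hs.trans (mem_Ioi.1 ht).le))
    positivity
  have hlim : Tendsto g atTop (𝓝 0) := by
    have h1 : Tendsto (fun t : ℝ => Real.exp (-((c - ξ) * t))) atTop (𝓝 0) := by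
      apply Real.tendsto_exp_neg_atTop_nhds_zero.comp
      exact tendsto_id.const_mul_atTop (by linarith)
    have h2 : Tendsto (fun t : ℝ => Real.exp (-((c + ξ) * t))) atTop (𝓝 0) := by
      apply Real.tendsto_exp_neg_atTop_nhds_zero.comp
      exact tendsto_id.const_mul_atTop (by linarith)
    have h3 := ((h1.const_mul (ξ * (ξ + c) / 2)).add (h2.const_mul (ξ * (ξ - c) / 2))).const_mul
      (-(Real.exp (c * s) / (c ^ 2 - ξ ^ 2)))
    simp only [mul_zero, add_zero] at h3
    refine h3.congr fun t => ?_
    simp only [hg]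
    have e1 : Real.exp (-((c - ξ) * t)) = Real.exp (-(c * t)) * Real.exp (ξ * t) := by
      rw [← Real.exp_add]; ring_nf
    have e2 : Real.exp (-((c + ξ) * t)) = Real.exp (-(c * t)) * Real.exp (-(ξ * t)) := by
      rw [← Real.exp_add]; ring_nf
    have e3 : Real.exp (-(c * (t - s))) = Real.exp (c * s) * Real.exp (-(c * t)) := by
      rw [← Real.exp_add]; ring_nf
    rw [e1, e2, e3, Real.cosh_eq, Real.sinh_eq]
    ring
  rw [← ofReal_integral_eq_lintegral_ofReal, integral_Ioi_of_hasDerivAt_of_nonneg' hd hpos hlim]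
  · congr 1
    simp [hg]
  · exact integrableOn_Ioi_deriv_of_nonneg' hd hpos hlim
  · exact (ae_restrict_iff' measurableSet_Ioi).2 (ae_of_all _ hpos)

/-- Exponential moments under a tail bound that is affine up to `s` and exponential afterwards. -/
theorem lintegral_cosh_le_of_tail_le (ν : Measure ℝ) [IsProbabilityMeasure ν] {c s η : ℝ}
    (hc : 0 < c) (hs : 0 ≤ s) (hη0 : 0 < η) (hη1 : η < 1)
    (h1 : ∀ z ∈ Icc 0 s, ν.real {x | z ≤ |x|} ≤ 1 - c / (1 + c * s) * z)
    (h2 : ∀ z, s ≤ z → ν.real {x | z ≤ |x|} ≤ Real.exp (-(c * (z - s))) / (1 + c * s)) :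
    ∫⁻ x, ENNReal.ofReal (Real.cosh (c * η * x)) ∂ν ≤ ENNReal.ofReal
      (1 / (1 - η ^ 2) * ((Real.cosh (η * (c * s)) + Real.sinh (η * (c * s)) / η) / (1 + c * s))) := by
  set ξ := c * η with hξdef
  have hξ : 0 < ξ := by positivity
  have hξc : ξ < c := by nlinarith
  have hcs : 0 < 1 + c * s := by positivity
  have hsc : Continuous fun t => ξ * Real.sinh (ξ * t) := by
    have := Real.continuous_sinh
    fun_prop
  have hint : ∀ a : ℝ, ∫ t in 0..a, ξ * Real.sinh (ξ * t) = Real.cosh (ξ * a) - 1 := by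
    intro a
    rw [intervalIntegral.integral_eq_sub_of_hasDerivAt (f := fun t => Real.cosh (ξ * t))]
    · simp
    · intro t _
      have h1 : HasDerivAt (fun t : ℝ => ξ * t) ξ t := by
        simpa using (hasDerivAt_id t).const_mul ξ
      exact h1.cosh.congr_deriv (mul_comm _ _)
    · exact hsc.intervalIntegrable _ _
  -- Layer cake formula for cosh(ξ|x|) - 1, which brings in the two-sided tail with weight ξ
  -- sinh(ξt).
  have hlc := lintegral_comp_eq_lintegral_meas_le_mul ν (f := fun x : ℝ => |x|)
    (g := fun t => ξ * Real.sinh (ξ * t)) (ae_of_all _ fun x => abs_nonneg x)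
    (measurable_id.abs.aemeasurable) (fun t _ => hsc.intervalIntegrable _ _)
    ((ae_restrict_iff' measurableSet_Ioi).2 (ae_of_all _ fun t ht => by
      have : 0 ≤ Real.sinh (ξ * t) := Real.sinh_nonneg_iff.2 (mul_nonneg hξ.le (le_of_lt ht))
      positivity))
  simp only [hint] at hlc
  have hsplit : ∫⁻ x, ENNReal.ofReal (Real.cosh (ξ * x)) ∂ν
      = 1 + ∫⁻ x, ENNReal.ofReal (Real.cosh (ξ * |x|) - 1) ∂ν := by
    have : ∀ x : ℝ, ENNReal.ofReal (Real.cosh (ξ * x))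
        = 1 + ENNReal.ofReal (Real.cosh (ξ * |x|) - 1) := by
      intro x
      rw [← ENNReal.ofReal_one, ← ENNReal.ofReal_add zero_le_one
        (sub_nonneg.2 (Real.one_le_cosh _))]
      congr 1
      rw [← Real.cosh_abs (ξ * x), abs_mul, abs_of_pos hξ]
      ring
    simp_rw [this]
    rw [lintegral_add_left measurable_const]
    simp
  have hun : Ioi (0 : ℝ) = Ioc 0 s ∪ Ioi s := (Ioc_union_Ioi_eq_Ioi hs).symm
  have hle1 : ∫⁻ t in Ioc 0 s, ν {a | t ≤ |a|} * ENNReal.ofReal (ξ * Real.sinh (ξ * t))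
      ≤ ∫⁻ t in Ioc 0 s, ENNReal.ofReal
        ((1 - c / (1 + c * s) * t) * (ξ * Real.sinh (ξ * t))) := by
    refine setLIntegral_mono' measurableSet_Ioc fun t ht => ?_
    have := h1 t ⟨ht.1.le, ht.2⟩
    rw [ENNReal.ofReal_mul (measureReal_nonneg.trans this)]
    gcongr
    rw [← ofReal_measureReal]
    exact ENNReal.ofReal_le_ofReal this
  have hle2 : ∫⁻ t in Ioi s, ν {a | t ≤ |a|} * ENNReal.ofReal (ξ * Real.sinh (ξ * t))
      ≤ ENNReal.ofReal (1 / (1 + c * s)) * ∫⁻ t in Ioi s, ENNReal.ofReal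
        (Real.exp (-(c * (t - s))) * (ξ * Real.sinh (ξ * t))) := by
    rw [← lintegral_const_mul' _ _ ENNReal.ofReal_ne_top]
    refine setLIntegral_mono' measurableSet_Ioi fun t ht => ?_
    have := h2 t (le_of_lt ht)
    rw [ENNReal.ofReal_mul (Real.exp_pos _).le, ← mul_assoc, ← ENNReal.ofReal_mul (by positivity)]
    gcongr
    rw [← ofReal_measureReal]
    refine ENNReal.ofReal_le_ofReal (this.trans (le_of_eq ?_))
    ring
  have hk : c / (1 + c * s) * s ≤ 1 := by
    rw [div_mul_eq_mul_div, div_le_one hcs]; linarith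
  have hch : 1 ≤ Real.cosh (ξ * s) := Real.one_le_cosh _
  have hsh : 0 ≤ Real.sinh (ξ * s) := Real.sinh_nonneg_iff.2 (by positivity)
  rw [hsplit, hlc, hun, lintegral_union measurableSet_Ioi
    (Set.disjoint_left.2 fun t ht ht' => not_lt.2 ht.2 ht')]
  have hne : c ^ 2 - ξ ^ 2 > 0 := by nlinarith
  calc _ ≤ ENNReal.ofReal 1 + (ENNReal.ofReal ((1 - c / (1 + c * s) * s) * Real.cosh (ξ * s)
          + c / (1 + c * s) / ξ * Real.sinh (ξ * s) - 1)
        + ENNReal.ofReal (1 / (1 + c * s)) * ENNReal.ofReal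
          (ξ * (ξ * Real.cosh (ξ * s) + c * Real.sinh (ξ * s)) / (c ^ 2 - ξ ^ 2))) := by
        rw [ENNReal.ofReal_one]
        gcongr
        · exact hle1.trans_eq (setLIntegral_Ioc_sinh_mul_affine hξ hs hk (by positivity))
        · exact hle2.trans_eq (by rw [setLIntegral_Ioi_sinh_mul_exp hξ hξc hs])
    _ = _ := by
        -- Needed because `ENNReal.ofReal` truncates negative values and is additive only on
        -- nonnegative ones.
        have hnn : 0 ≤ (1 - c / (1 + c * s) * s) * Real.cosh (ξ * s)
          + c / (1 + c * s) / ξ * Real.sinh (ξ * s) - 1 := by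
          have e : (1 - c / (1 + c * s) * s) * Real.cosh (ξ * s)
            + c / (1 + c * s) / ξ * Real.sinh (ξ * s) - 1
            = (Real.cosh (ξ * s) - 1 + (c / ξ) * (Real.sinh (ξ * s) - ξ * s)) / (1 + c * s) := by
            field_simp
            ring
          have h3 : ξ * s ≤ Real.sinh (ξ * s) := Real.self_le_sinh_iff.2 (by positivity)
          rw [e]
          have h4 : 0 ≤ Real.cosh (ξ * s) - 1 := by linarith
          have h5 : 0 ≤ Real.sinh (ξ * s) - ξ * s := by linarith
          positivity
        rw [← ENNReal.ofReal_mul (by positivity), ← ENNReal.ofReal_add hnn (by positivity),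
          ← ENNReal.ofReal_add zero_le_one (by positivity)]
        congr 1
        have e : η * (c * s) = ξ * s := by rw [hξdef]; ring
        rw [e]
        have hη2 : 1 - η ^ 2 ≠ 0 := by nlinarith
        have e2 : c ^ 2 - ξ ^ 2 = c ^ 2 * (1 - η ^ 2) := by rw [hξdef]; ring
        rw [e2]
        generalize Real.cosh (ξ * s) = C
        generalize Real.sinh (ξ * s) = D
        rw [hξdef]
        field_simp
        ring

/-! ### Tails of symmetric log-concave laws -/

theorem measurableSet_le_abs (z : ℝ) : MeasurableSet {x : ℝ | z ≤ |x|} :=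
  measurableSet_le measurable_const measurable_id.abs

/-- The two-sided tail `z ↦ ν {x | z ≤ |x|}`. -/
def tail (ν : Measure ℝ) (z : ℝ) : ℝ := ν.real {x | z ≤ |x|}

theorem continuous_tail (ν : Measure ℝ) [IsProbabilityMeasure ν] [NullSingletonClass ν] :
    Continuous (tail ν) := by
  have e : tail ν = fun z => ∫ x, {x : ℝ | z ≤ |x|}.indicator (fun _ => (1 : ℝ)) x ∂ν := by
    funext z
    rw [integral_indicator_const _ (measurableSet_le_abs z)]
    simp [tail]
  rw [e, continuous_iff_continuousAt]
  intro z
  refine continuousAt_of_dominated (bound := fun _ => 1)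
    (Eventually.of_forall fun w => (measurable_const.indicator (measurableSet_le_abs w)).aestronglyMeasurable)
    (Eventually.of_forall fun w => ae_of_all _ fun x => ?_) (integrable_const _) ?_
  · by_cases h : w ≤ |x| <;> simp [indicator, h]
  · have h1 : ∀ᵐ x ∂ν, x ≠ z := by simp [ae_iff]
    have h2 : ∀ᵐ x ∂ν, x ≠ -z := by simp [ae_iff]
    filter_upwards [h1, h2] with x hx1 hx2
    have hne : z ≠ |x| := by
      intro h
      rcases abs_choice x with h' | h'
      · exact hx1 (by rw [h, h'])
      · exact hx2 (by rw [h, h']; simp)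
    rcases lt_or_gt_of_ne hne with h | h
    · refine (continuousAt_const (y := (1 : ℝ))).congr ?_
      filter_upwards [gt_mem_nhds h] with w hw
      simp [indicator, hw.le]
    · refine (continuousAt_const (y := (0 : ℝ))).congr ?_
      filter_upwards [lt_mem_nhds h] with w hw
      simp [indicator, hw]

theorem tail_antitone (ν : Measure ℝ) [IsFiniteMeasure ν] : Antitone (tail ν) :=
  fun _ _ h => measureReal_mono fun _ hx => h.trans hx

theorem measurable_tail_abs (ν : Measure ℝ) [IsFiniteMeasure ν] :
    Measurable fun x => tail ν |x| :=
  (tail_antitone ν).measurable.comp measurable_id.abs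

theorem tail_zero (ν : Measure ℝ) [IsProbabilityMeasure ν] : tail ν 0 = 1 := by
  simp [tail]

theorem tail_nonneg (ν : Measure ℝ) (z : ℝ) : 0 ≤ tail ν z := measureReal_nonneg

theorem tendsto_tail_atTop (ν : Measure ℝ) [IsProbabilityMeasure ν] :
    Tendsto (tail ν) atTop (𝓝 0) := by
  have h : Tendsto (fun z : ℝ => ν {x | z ≤ |x|}) atTop (𝓝 (ν (⋂ z : ℝ, {x | z ≤ |x|}))) := by
    refine tendsto_measure_iInter_atTop (fun z => ?_) (fun a b h x hx => h.trans hx)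
      ⟨0, measure_ne_top _ _⟩
    exact (measurableSet_le_abs z).nullMeasurableSet
  have he : (⋂ z : ℝ, {x : ℝ | z ≤ |x|}) = ∅ := by
    ext x
    simp only [mem_iInter, mem_ofPred_eq, mem_empty_iff_false, iff_false, not_forall, not_le]
    exact exists_gt _
  rw [he, measure_empty] at h
  exact (ENNReal.tendsto_toReal ENNReal.zero_ne_top).comp h

theorem measure_neg_preimage {ν : Measure ℝ} (hs : ν.map (fun x => -x) = ν) (A : Set ℝ) (hA : MeasurableSet A) :
    ν ((fun x => -x) ⁻¹' A) = ν A := by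
  conv_rhs => rw [← hs, Measure.map_apply measurable_neg hA]

/-- A symmetric log-concave measure is unimodal. -/
theorem measure_Icc_le_of_le {ν : Measure ℝ} (hs : ν.map (fun x => -x) = ν) (hlc : IsLogConcave ν)
    {a b h : ℝ} (hb : 0 ≤ b) (hba : b ≤ a) (hh : 0 ≤ h) : ν (Icc a (a + h)) ≤ ν (Icc b (b + h)) := by
  rcases hba.eq_or_lt with rfl | hlt
  · exact le_rfl
  have hpos : 0 < 2 * a + h := by linarith
  -- Mixing the interval with its mirror image at weight t translates it left by t(2a + h), so this
  -- t lands exactly on [b, b + h].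
  set t := (a - b) / (2 * a + h) with ht
  have ht0 : 0 < t := div_pos (by linarith) hpos
  have ht1 : t < 1 := (div_lt_one hpos).2 (by linarith)
  have htm : t * (2 * a + h) = a - b := div_mul_cancel₀ _ hpos.ne'
  have hB : ν (Icc (-(a + h)) (-a)) = ν (Icc a (a + h)) := by
    rw [← measure_neg_preimage hs _ measurableSet_Icc]
    congr 1
    ext x
    simp only [mem_preimage, mem_Icc]
    constructor <;> rintro ⟨h1, h2⟩ <;> constructor <;> linarith
  have h1 := hlc (Icc a (a + h)) (Icc (-(a + h)) (-a)) measurableSet_Icc measurableSet_Icc t ht0 ht1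
  rw [hB, ← ENNReal.rpow_add_of_nonneg _ _ (by linarith) ht0.le, sub_add_cancel,
    ENNReal.rpow_one] at h1
  refine h1.trans (measure_mono ?_)
  rintro _ ⟨_, ⟨u, hu, rfl⟩, _, ⟨v, hv, rfl⟩, rfl⟩
  simp only [mem_Icc, smul_eq_mul] at *
  constructor <;> nlinarith

section LogConcave

variable {ν : Measure ℝ} [IsProbabilityMeasure ν]

/-- Unimodality spreads an atom at a > 0 to uncountably many atoms. An atom at 0 alone would, by
log-concavity against (0, v], force arbitrarily short intervals next to 0 to keep a fixed mass. -/
theorem noAtoms_of_isLogConcave (hs : ν.map (fun x => -x) = ν) (hlc : IsLogConcave ν)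
    (hnd : ∀ a : ℝ, ν {a} < 1) : NullSingletonClass ν := by
  have hposat : ∀ a : ℝ, 0 < a → ν {a} = 0 := by
    intro a ha
    by_contra hne
    have hcount : {x : ℝ | 0 < ν {x}}.Countable :=
      Measure.countable_meas_pos_of_disjoint_iUnion (μ := ν) (As := fun x : ℝ => {x})
        (fun x => measurableSet_singleton x)
        (fun x y hxy => by simpa [Function.onFun] using hxy)
    -- Unimodality for intervals of length 0.
    have hsub : Icc 0 a ⊆ {x : ℝ | 0 < ν {x}} := by
      intro b hb
      have := measure_Icc_le_of_le hs hlc hb.1 hb.2 le_rfl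
      simp only [add_zero, Icc_self] at this
      exact (pos_iff_ne_zero.2 hne).trans_le this
    have := (hcount.mono hsub).measure_zero volume
    simp at this
    linarith
  have hzero : ν {0} = 0 := by
    by_contra hne
    have hIoi : ν (Ioi 0) ≠ 0 := by
      intro h0
      have h1 : ν (Iio 0) = 0 := by
        rw [← h0, ← measure_neg_preimage hs _ measurableSet_Ioi]
        congr 1
        ext x
        simp
      have : ν {0}ᶜ = 0 := by
        rw [← Iio_union_Ioi]
        exact measure_union_null h1 h0
      have h2 := (prob_compl_eq_zero_iff (measurableSet_singleton (0 : ℝ))).1 this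
      exact (hnd 0).ne h2
    obtain ⟨v, hv⟩ : ∃ n : ℕ, ν (Ioc 0 (n : ℝ)) ≠ 0 := by
      by_contra! hall
      apply hIoi
      have : Ioi (0 : ℝ) = ⋃ n : ℕ, Ioc 0 (n : ℝ) := by
        ext x
        simp only [mem_Ioi, mem_iUnion, mem_Ioc]
        exact ⟨fun h => (exists_nat_ge x).imp fun n hn => ⟨h, hn⟩, fun ⟨n, h, _⟩ => h⟩
      rw [this]
      exact measure_iUnion_null hall
    have hlow : ∀ n : ℕ, ν {0} * ν (Ioc 0 (v : ℝ)) ≤ ν (Ioc 0 (v / (n + 2 : ℝ))) := by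
      intro n
      set t : ℝ := 1 / (n + 2) with ht
      have ht0 : 0 < t := by positivity
      have ht1 : t < 1 := by
        rw [ht, div_lt_one (by positivity)]
        linarith [(Nat.cast_nonneg n : (0 : ℝ) ≤ n)]
      have h1 := hlc {0} (Ioc 0 (v : ℝ)) (measurableSet_singleton _) measurableSet_Ioc t ht0 ht1
      calc ν {0} * ν (Ioc 0 (v : ℝ)) ≤ ν {0} ^ (1 - t) * ν (Ioc 0 (v : ℝ)) ^ t := by
            gcongr
            · conv_lhs => rw [← ENNReal.rpow_one (ν {0})]
              exact ENNReal.rpow_le_rpow_of_exponent_ge prob_le_one (by linarith)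
            · conv_lhs => rw [← ENNReal.rpow_one (ν (Ioc 0 (v : ℝ)))]
              exact ENNReal.rpow_le_rpow_of_exponent_ge prob_le_one ht1.le
        _ ≤ _ := h1
        _ ≤ _ := by
            refine measure_mono ?_
            rintro _ ⟨_, ⟨u, hu, rfl⟩, _, ⟨w, hw, rfl⟩, rfl⟩
            simp only [mem_singleton_iff] at hu
            subst hu
            simp only [smul_eq_mul, mul_zero, zero_add, mem_Ioc] at *
            refine ⟨mul_pos ht0 hw.1, ?_⟩
            rw [ht, div_mul_eq_mul_div, one_mul]
            gcongr
            exact hw.2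
    have hlim : Tendsto (fun n : ℕ => ν (Ioc 0 (v / (n + 2 : ℝ)))) atTop
        (𝓝 (ν (⋂ n : ℕ, Ioc 0 (v / (n + 2 : ℝ))))) := by
      refine tendsto_measure_iInter_atTop (fun n => measurableSet_Ioc.nullMeasurableSet) ?_
        ⟨0, measure_ne_top _ _⟩
      intro m n hmn
      refine Ioc_subset_Ioc_right ?_
      gcongr
    have he : (⋂ n : ℕ, Ioc 0 (v / (n + 2 : ℝ))) = ∅ := by
      ext x
      simp only [mem_iInter, mem_Ioc, mem_empty_iff_false, iff_false, not_forall]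
      by_cases hx : 0 < x
      · obtain ⟨n, hn⟩ := exists_nat_gt (v / x)
        refine ⟨n, fun h => ?_⟩
        have h2 := h.2
        rw [le_div_iff₀ (by positivity)] at h2
        rw [div_lt_iff₀ hx] at hn
        nlinarith
      · exact ⟨0, fun h => hx h.1⟩
    rw [he, measure_empty] at hlim
    have := ge_of_tendsto' hlim hlow
    simp only [nonpos_iff_eq_zero, mul_eq_zero] at this
    exact this.elim hne hv
  refine ⟨fun a => ?_⟩
  rcases lt_trichotomy a 0 with h | rfl | h
  · rw [← hposat (-a) (by linarith), ← measure_neg_preimage hs _ (measurableSet_singleton (-a))]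
    congr 1
    ext x
    simp
  · exact hzero
  · exact hposat a h

variable [NullSingletonClass ν]

theorem tail_eq_two_mul (hs : ν.map (fun x => -x) = ν) {z : ℝ} (hz : 0 ≤ z) :
    tail ν z = 2 * ν.real (Ici z) := by
  have hset : {x : ℝ | z ≤ |x|} = Ici z ∪ Iic (-z) := by
    ext x
    simp only [mem_ofPred_eq, le_abs, mem_union, mem_Ici, mem_Iic]
    constructor <;> rintro (h | h) <;> first | (left; linarith) | (right; linarith)
  have hneg : ν.real (Iic (-z)) = ν.real (Ici z) := by
    unfold Measure.real
    rw [← measure_neg_preimage hs _ measurableSet_Ici]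
    congr 2
    ext x
    simp only [mem_Iic, mem_preimage, mem_Ici]
    constructor <;> intro h <;> linarith
  have hd : AEDisjoint ν (Ici z) (Iic (-z)) := by
    refine measure_mono_null (t := {0}) ?_ (measure_singleton 0)
    rintro x ⟨h1, h2⟩
    simp only [mem_Ici, mem_Iic, mem_singleton_iff] at *
    linarith
  rw [tail, hset, measureReal_def, measure_union₀ measurableSet_Iic.nullMeasurableSet hd,
    ENNReal.toReal_add (measure_ne_top _ _) (measure_ne_top _ _), ← measureReal_def,
    ← measureReal_def, hneg]
  ring

/-- By symmetry the two-sided tail is twice a half-line mass, and half-lines are stable under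
Minkowski combinations; the factors 2^{1-t} and 2^t recombine to 2. -/
theorem tail_rpow_mul_le (hs : ν.map (fun x => -x) = ν) (hlc : IsLogConcave ν) {a b : ℝ}
    (ha : 0 ≤ a) (hb : 0 ≤ b) {t : ℝ} (ht0 : 0 < t) (ht1 : t < 1) :
    tail ν a ^ (1 - t) * tail ν b ^ t ≤ tail ν ((1 - t) * a + t * b) := by
  have ht' : 0 < 1 - t := by linarith
  rw [tail_eq_two_mul hs ha, tail_eq_two_mul hs hb, tail_eq_two_mul hs (by positivity),
    Real.mul_rpow zero_le_two measureReal_nonneg, Real.mul_rpow zero_le_two measureReal_nonneg]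
  have h2 : (2 : ℝ) ^ (1 - t) * 2 ^ t = 2 := by
    rw [← Real.rpow_add zero_lt_two]; simp
  have h1 : ν (Ici a) ^ (1 - t) * ν (Ici b) ^ t ≤ ν (Ici ((1 - t) * a + t * b)) := by
    refine (hlc _ _ measurableSet_Ici measurableSet_Ici t ht0 ht1).trans (measure_mono ?_)
    rintro _ ⟨_, ⟨u, hu, rfl⟩, _, ⟨v, hv, rfl⟩, rfl⟩
    simp only [mem_Ici, smul_eq_mul] at *
    gcongr
  have h3 := ENNReal.toReal_mono (measure_ne_top _ _) h1
  rw [ENNReal.toReal_mul, ← ENNReal.toReal_rpow, ← ENNReal.toReal_rpow] at h3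
  simp only [← measureReal_def] at h3
  calc _ = 2 * (ν.real (Ici a) ^ (1 - t) * ν.real (Ici b) ^ t) := by
        linear_combination (ν.real (Ici a) ^ (1 - t) * ν.real (Ici b) ^ t) * h2
    _ ≤ _ := by linarith

/-- Midpoint convexity of the tail is unimodality: the decrements over consecutive intervals of
length h are twice the masses of those intervals, which do not increase. -/
theorem two_mul_tail_le (hs : ν.map (fun x => -x) = ν) (hlc : IsLogConcave ν) {a h : ℝ}
    (ha : 0 ≤ a) (hh : 0 ≤ h) : 2 * tail ν (a + h) ≤ tail ν a + tail ν (a + 2 * h) := by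
  have hsplit : ∀ b : ℝ, ν.real (Ici b) = ν.real (Icc b (b + h)) + ν.real (Ici (b + h)) := by
    intro b
    have hd : Disjoint (Ico b (b + h)) (Ici (b + h)) :=
      Set.disjoint_left.2 fun x hx hx' => not_le.2 hx.2 hx'
    have hu := measureReal_union (μ := ν) hd measurableSet_Ici
    rw [Ico_union_Ici_eq_Ici (show b ≤ b + h by linarith)] at hu
    rw [hu, measureReal_congr Ico_ae_eq_Icc]
  have h1 := hsplit a
  have h2 := hsplit (a + h)
  have h3 : ν.real (Icc (a + h) (a + h + h)) ≤ ν.real (Icc a (a + h)) :=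
    ENNReal.toReal_mono (measure_ne_top _ _) (measure_Icc_le_of_le hs hlc ha (by linarith) hh)
  rw [tail_eq_two_mul hs ha, tail_eq_two_mul hs (by linarith),
    tail_eq_two_mul hs (by linarith)]
  have e : a + 2 * h = a + h + h := by ring
  rw [e]
  linarith

end LogConcave

/-! ### The rate function of the double exponential law -/

/-- The Cramér transform of the standard double exponential distribution. -/
def expRate (y : ℝ) : ℝ := √(1 + y ^ 2) - 1 - Real.log ((1 + √(1 + y ^ 2)) / 2)

/-- The point at which the supremum defining `expRate y` is attained. -/
def expTilt (y : ℝ) : ℝ := y / (1 + √(1 + y ^ 2))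

theorem one_sub_expTilt_sq (y : ℝ) : 1 - expTilt y ^ 2 = 2 / (1 + √(1 + y ^ 2)) := by
  have h : √(1 + y ^ 2) ^ 2 = 1 + y ^ 2 := Real.sq_sqrt (by positivity)
  have hS : 0 ≤ √(1 + y ^ 2) := Real.sqrt_nonneg _
  rw [expTilt]
  field_simp
  linear_combination h

theorem expTilt_sq_lt_one (y : ℝ) : expTilt y ^ 2 < 1 := by
  have h := one_sub_expTilt_sq y
  have : 0 < 2 / (1 + √(1 + y ^ 2)) := by positivity
  linarith

theorem mul_expTilt_add_log (y : ℝ) :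
    y * expTilt y + Real.log (1 - expTilt y ^ 2) = expRate y := by
  have h : √(1 + y ^ 2) ^ 2 = 1 + y ^ 2 := Real.sq_sqrt (by positivity)
  have hS : 0 ≤ √(1 + y ^ 2) := Real.sqrt_nonneg _
  rw [one_sub_expTilt_sq, expRate, expTilt,
    show y * (y / (1 + √(1 + y ^ 2))) = √(1 + y ^ 2) - 1 by field_simp; linear_combination -h,
    ← inv_div, Real.log_inv]
  ring

/-- The bound log v ≤ v - 1 at v = (1 - ξ²)(1 + S)/2, an equality at the optimal tilt, replaces the
logarithm by a quadratic in ξ; completing the square finishes. -/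
theorem mul_add_log_le_expRate (y : ℝ) {ξ : ℝ} (hξ : ξ ^ 2 < 1) :
    y * ξ + Real.log (1 - ξ ^ 2) ≤ expRate y := by
  have h : √(1 + y ^ 2) ^ 2 = 1 + y ^ 2 := Real.sq_sqrt (by positivity)
  have hS : 0 ≤ √(1 + y ^ 2) := Real.sqrt_nonneg _
  rw [expRate]
  set S := √(1 + y ^ 2)
  have h1 : 0 < 1 - ξ ^ 2 := by linarith
  have h2 := Real.log_le_sub_one_of_pos (show 0 < (1 - ξ ^ 2) * ((1 + S) / 2) by positivity)
  rw [Real.log_mul h1.ne' (by positivity)] at h2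
  have h3 : 0 ≤ (1 + S) / 2 * (ξ - y / (1 + S)) ^ 2 := by positivity
  have e : (1 + S) / 2 * (ξ - y / (1 + S)) ^ 2 = (1 + S) / 2 * ξ ^ 2 - y * ξ + (S - 1) / 2 := by
    field_simp
    linear_combination -h
  linarith

/-! ### Pointwise comparison with the double exponential law -/

theorem lintegral_exp_eq_lintegral_cosh {ν : Measure ℝ} (hs : ν.map (fun x => -x) = ν) (ξ : ℝ) :
    ∫⁻ z, ENNReal.ofReal (Real.exp (ξ * z)) ∂ν = ∫⁻ z, ENNReal.ofReal (Real.cosh (ξ * z)) ∂ν := by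
  have hneg : ∫⁻ z, ENNReal.ofReal (Real.exp (-(ξ * z))) ∂ν
      = ∫⁻ z, ENNReal.ofReal (Real.exp (ξ * z)) ∂ν := by
    conv_rhs => rw [← hs]
    rw [lintegral_map (by fun_prop) measurable_neg]
    simp
  have h : ∀ z : ℝ, ENNReal.ofReal (Real.cosh (ξ * z)) = 2⁻¹ *
      (ENNReal.ofReal (Real.exp (ξ * z)) + ENNReal.ofReal (Real.exp (-(ξ * z)))) := by
    intro z
    rw [← ENNReal.ofReal_add (Real.exp_pos _).le (Real.exp_pos _).le,
      show (2 : ℝ≥0∞)⁻¹ = ENNReal.ofReal 2⁻¹ by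
        rw [ENNReal.ofReal_inv_of_pos zero_lt_two]; simp,
      ← ENNReal.ofReal_mul (by norm_num), Real.cosh_eq]
    congr 1
    ring
  simp_rw [h]
  rw [lintegral_const_mul _ (by fun_prop), lintegral_add_left (by fun_prop), hneg, ← two_mul,
    ← mul_assoc, ENNReal.inv_mul_cancel two_ne_zero ENNReal.ofNat_ne_top, one_mul]

/-- The pointwise comparison of a symmetric log-concave law with the double exponential law: the
Cramér transform at `x` is at least `expRate` at the point with the same tail. -/
theorem exists_lintegral_exp_le {ν : Measure ℝ} [IsProbabilityMeasure ν] [NullSingletonClass ν]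
    (hs : ν.map (fun x => -x) = ν) (hlc : IsLogConcave ν) {x : ℝ} (hx : x ≠ 0)
    (h0 : 0 < tail ν |x|) (h1 : tail ν |x| < 1) :
    ∃ ξ : ℝ, ∫⁻ z, ENNReal.ofReal (Real.exp (ξ * z)) ∂ν
      ≤ ENNReal.ofReal (Real.exp (x * ξ - expRate (-Real.log (tail ν |x|)))) := by
  have hx' : 0 < |x| := abs_pos.2 hx
  set u := |x| with hu
  set y := -Real.log (tail ν u) with hy
  have hy0 : 0 < y := neg_pos.2 (Real.log_neg h0 h1)
  have hTu : tail ν u = Real.exp (-y) := by rw [hy, neg_neg, Real.exp_log h0]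
  obtain ⟨c, hc⟩ := exists_exp_tangent (tail_nonneg ν) (continuous_tail ν)
    (fun a b ha hb t ht0 ht1 => tail_rpow_mul_le hs hlc ha hb ht0 ht1)
    (by rw [tail_zero]; exact one_pos) hx' h0
  -- The supporting exponential dominates T(0) = 1 at the origin; this forces c > 0 and makes the
  -- tangency equation below solvable.
  have hycu : y ≤ c * u := by
    have := hc 0 le_rfl
    rw [tail_zero, hTu, ← Real.exp_add, Real.one_le_exp_iff] at this
    linarith
  have hcpos : 0 < c := by
    by_contra! hneg
    nlinarith
  -- With s = σ/c the exponential has value 1/(1+σ) and slope -c/(1+σ) at s, so its tangent there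
  -- passes through (0,1).
  obtain ⟨σ, hσ0, hσ⟩ := exists_one_add_mul_exp_neg_eq (Real.exp_pos (y - c * u))
    (Real.exp_le_one_iff.2 (by linarith))
  set s := σ / c with hsdef
  have hcs : c * s = σ := mul_div_cancel₀ _ hcpos.ne'
  have hs0 : 0 ≤ s := by positivity
  have hσ1 : Real.exp (-y + c * u - σ) = 1 / (1 + σ) := by
    rw [eq_div_iff (by positivity)]
    have : Real.exp (-y + c * u - σ) = Real.exp (-σ) / Real.exp (y - c * u) := by
      rw [← Real.exp_sub]; ring_nf
    rw [this, div_mul_eq_mul_div, div_eq_one_iff_eq (Real.exp_ne_zero _), ← hσ]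
    ring
  have htail2 : ∀ z, s ≤ z → tail ν z ≤ Real.exp (-(c * (z - s))) / (1 + c * s) := by
    intro z hz
    refine (hc z (hs0.trans hz)).trans (le_of_eq ?_)
    rw [hcs, div_eq_mul_one_div, ← hσ1, hTu, ← Real.exp_add, ← Real.exp_add]
    congr 1
    rw [← hcs]
    ring
  have htail1 : ∀ z ∈ Icc 0 s, tail ν z ≤ 1 - c / (1 + c * s) * z := by
    intro z hz
    refine le_chord_of_midpoint (continuous_tail ν)
      (fun a h ha hh => two_mul_tail_le hs hlc ha hh) (tail_zero ν).le ?_ hz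
    refine (htail2 s le_rfl).trans (le_of_eq ?_)
    have : 0 < 1 + c * s := by positivity
    simp
    field_simp
    ring
  -- The optimal double exponential tilt at y, rescaled below by the rate c.
  set η := expTilt y with hη
  have hη0 : 0 < η := by rw [hη, expTilt]; positivity
  have hη1 : η < 1 := by
    have := expTilt_sq_lt_one y
    rw [← hη] at this
    nlinarith
  have hη2 : 0 < 1 - η ^ 2 := by nlinarith
  have hbound : ∫⁻ z, ENNReal.ofReal (Real.cosh (c * η * z)) ∂ν
      ≤ ENNReal.ofReal (Real.exp (u * (c * η) - expRate y)) := by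
    refine (lintegral_cosh_le_of_tail_le ν hcpos hs0 hη0 hη1 htail1 htail2).trans
      (ENNReal.ofReal_le_ofReal ?_)
    rw [hcs]
    calc _ ≤ 1 / (1 - η ^ 2) * (Real.exp (η * σ) * (1 + σ) ^ (-η)) :=
          mul_le_mul_of_nonneg_left (cosh_add_sinh_div_le hη0 hη1 hσ0) (by positivity)
      _ = _ := by
          -- By this identity e^{ησ}(1+σ)^{-η} = e^{η(cu - y)}: σ cancels, leaving exactly the
          -- exponent of the claim.
          have hl : Real.log (1 + σ) = y - c * u + σ := by
            have : 1 + σ = Real.exp (y - c * u + σ) := by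
              rw [Real.exp_add, ← hσ, mul_assoc, ← Real.exp_add]; simp
            rw [this, Real.log_exp]
          rw [Real.rpow_def_of_pos (by positivity), hl, ← mul_expTilt_add_log y, ← hη,
            ← Real.exp_add, sub_add_eq_sub_sub, Real.exp_sub _ (Real.log _), Real.exp_log hη2,
            one_div_mul_eq_div]
          congr 2
          ring
  rcases abs_choice x with h | h
  · refine ⟨c * η, ?_⟩
    rw [lintegral_exp_eq_lintegral_cosh hs]
    refine hbound.trans_eq ?_
    rw [hu, h]
  · refine ⟨-(c * η), ?_⟩
    rw [lintegral_exp_eq_lintegral_cosh hs]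
    simp only [neg_mul, Real.cosh_neg]
    refine hbound.trans_eq ?_
    rw [hu, h]
    ring_nf

/-! ### Uniform distribution of the tail -/

/-- For an atomless law the tail evaluated at the variable is uniformly distributed. -/
theorem map_tail_abs (ν : Measure ℝ) [IsProbabilityMeasure ν] [NullSingletonClass ν] :
    ν.map (fun x => tail ν |x|) = volume.restrict (Icc 0 1) := by
  have hm := measurable_tail_abs ν
  have hle1 : ∀ x : ℝ, tail ν |x| ≤ 1 := fun x => by
    rw [← tail_zero ν]; exact tail_antitone ν (abs_nonneg x)
  have hmid : ∀ u : ℝ, 0 < u → u < 1 → ν {x | tail ν |x| ≤ u} = ENNReal.ofReal u := by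
    intro u hu0 hu1
    obtain ⟨M, hM, hM0⟩ := (((tendsto_tail_atTop ν).eventually (gt_mem_nhds hu0)).and
      (eventually_ge_atTop 0)).exists
    have hK : IsCompact (Icc 0 M ∩ tail ν ⁻¹' {u}) :=
      isCompact_Icc.inter_right (isClosed_singleton.preimage (continuous_tail ν))
    obtain ⟨p, hp, hpu⟩ := intermediate_value_Icc' hM0 (continuous_tail ν).continuousOn
      (show u ∈ Icc (tail ν M) (tail ν 0) from ⟨hM.le, by rw [tail_zero]; exact hu1.le⟩)
    -- The leftmost point at level u: the tail may be flat there, and only from this point does the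
    -- sublevel set become {m ≤ |x|}.
    obtain ⟨m, hm1, hm2⟩ := hK.exists_isMinOn ⟨p, hp, hpu⟩ continuousOn_id
    have hmu : tail ν m = u := hm1.2
    have hset : {x : ℝ | tail ν |x| ≤ u} = {x | m ≤ |x|} := by
      ext x
      simp only [mem_ofPred_eq]
      constructor
      · intro h
        by_contra! hlt
        have h2 : u ≤ tail ν |x| := hmu ▸ tail_antitone ν hlt.le
        have : m ≤ |x| := hm2 (show |x| ∈ Icc 0 M ∩ tail ν ⁻¹' {u} from
          ⟨⟨abs_nonneg x, hlt.le.trans hm1.1.2⟩, le_antisymm h h2⟩)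
        linarith
      · intro h
        exact hmu ▸ tail_antitone ν h
    rw [hset, ← ofReal_measureReal]
    exact congrArg _ hmu
  have : IsProbabilityMeasure (ν.map fun x => tail ν |x|) :=
    Measure.isProbabilityMeasure_map hm.aemeasurable
  refine Measure.ext_of_Iic _ _ fun u => ?_
  rw [Measure.map_apply hm measurableSet_Iic, Measure.restrict_apply measurableSet_Iic]
  change ν {x | tail ν |x| ≤ u} = _
  rcases lt_or_ge u 1 with hu1 | hu1
  · have e : Iic u ∩ Icc (0 : ℝ) 1 = Icc 0 u := by
      ext x
      simp only [mem_inter_iff, mem_Iic, mem_Icc]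
      constructor
      · rintro ⟨h1, h2, h3⟩; exact ⟨h2, h1⟩
      · rintro ⟨h1, h2⟩; exact ⟨h2, h1, by linarith⟩
    rw [e, Real.volume_Icc, sub_zero]
    rcases lt_or_ge 0 u with hu0 | hu0
    · exact hmid u hu0 hu1
    · rw [ENNReal.ofReal_of_nonpos hu0]
      refine le_antisymm (ENNReal.le_of_forall_pos_le_add fun ε hε _ => ?_) bot_le
      rw [zero_add]
      have hmin : 0 < min (ε : ℝ) (1 / 2) := lt_min hε (by norm_num)
      calc ν {x | tail ν |x| ≤ u} ≤ ν {x | tail ν |x| ≤ min (ε : ℝ) (1 / 2)} :=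
            measure_mono fun x (hx : _ ≤ _) => hx.trans (hu0.trans hmin.le)
        _ = ENNReal.ofReal (min (ε : ℝ) (1 / 2)) :=
            hmid _ hmin ((min_le_right _ _).trans_lt (by norm_num))
        _ ≤ ENNReal.ofReal ε := ENNReal.ofReal_le_ofReal (min_le_left _ _)
        _ = ε := ENNReal.ofReal_coe_nnreal
  · have e : Iic u ∩ Icc (0 : ℝ) 1 = Icc 0 1 :=
      inter_eq_right.2 fun x hx => hx.2.trans hu1
    have e2 : {x : ℝ | tail ν |x| ≤ u} = univ := eq_univ_of_forall fun x => (hle1 x).trans hu1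
    rw [e, e2, measure_univ]
    simp

theorem ae_tail_mem_Ioo (ν : Measure ℝ) [IsProbabilityMeasure ν] [NullSingletonClass ν] :
    ∀ᵐ x ∂ν, tail ν |x| ∈ Ioo 0 1 := by
  have hm := measurable_tail_abs ν
  refine ae_of_ae_map hm.aemeasurable ?_
  rw [map_tail_abs, ← restrict_Ioo_eq_restrict_Icc]
  exact ae_restrict_mem measurableSet_Ioo

/-! ### Laplace and Cramér transforms of the double exponential law -/

theorem lintegral_eq_lintegral_Ioi_add_neg {F : ℝ → ℝ≥0∞} (hF : Measurable F) :
    ∫⁻ x, F x = ∫⁻ t in Ioi 0, (F t + F (-t)) := by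
  have h1 : ∫⁻ x in Iic 0, F x = ∫⁻ t in Ioi 0, F (-t) := by
    have := (Measure.measurePreserving_neg (volume : Measure ℝ)).setLIntegral_comp_preimage
      (measurableSet_Iic (a := (0 : ℝ))) hF
    rw [← this, restrict_Ioi_eq_restrict_Ici]
    congr 2
    ext x
    simp
  rw [← lintegral_add_compl F (measurableSet_Ioi (a := (0 : ℝ))), compl_Ioi, h1,
    lintegral_add_left hF]

theorem lintegral_doubleExponential {g : ℝ → ℝ≥0∞} (hg : Measurable g) :
    ∫⁻ x, g x ∂doubleExponential
      = ∫⁻ t in Ioi 0, ENNReal.ofReal (1 / 2 * Real.exp (-t)) * (g t + g (-t)) := by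
  rw [doubleExponential, lintegral_withDensity_eq_lintegral_mul _ (by fun_prop) hg,
    lintegral_eq_lintegral_Ioi_add_neg (by fun_prop)]
  refine setLIntegral_congr_fun measurableSet_Ioi fun t ht => ?_
  simp only [Pi.mul_apply, abs_neg, abs_of_pos (mem_Ioi.1 ht), mul_add]

theorem setLIntegral_Ioi_exp_neg_mul {a : ℝ} (ha : 0 < a) (z : ℝ) :
    ∫⁻ t in Ioi z, ENNReal.ofReal (Real.exp (-a * t)) = ENNReal.ofReal (Real.exp (-a * z) / a) := by
  rw [← ofReal_integral_eq_lintegral_ofReal (integrableOn_exp_mul_Ioi (by linarith) z)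
    (ae_of_all _ fun t => (Real.exp_pos _).le), integral_exp_mul_Ioi (by linarith)]
  congr 1
  field_simp

theorem doubleExponential_le_abs {z : ℝ} (hz : 0 ≤ z) :
    doubleExponential {x | z ≤ |x|} = ENNReal.ofReal (Real.exp (-z)) := by
  rw [← lintegral_indicator_one (measurableSet_le_abs z), lintegral_doubleExponential
    (measurable_one.indicator (measurableSet_le_abs z))]
  have h : ∀ t ∈ Ioi (0 : ℝ), ENNReal.ofReal (1 / 2 * Real.exp (-t)) *
      ({x : ℝ | z ≤ |x|}.indicator 1 t + {x : ℝ | z ≤ |x|}.indicator 1 (-t))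
      = (Ici z).indicator (fun t => ENNReal.ofReal (Real.exp (-1 * t))) t := by
    intro t ht
    by_cases hzt : z ≤ t
    · have h2 : ENNReal.ofReal (1 / 2 * Real.exp (-t)) * 2 = ENNReal.ofReal (Real.exp (-t)) := by
        rw [← ENNReal.ofReal_ofNat 2, ← ENNReal.ofReal_mul (by positivity)]
        congr 1
        ring
      simp [indicator, abs_of_pos (mem_Ioi.1 ht), hzt, one_add_one_eq_two]
      simpa using h2
    · simp [indicator, abs_of_pos (mem_Ioi.1 ht), hzt]
  rw [setLIntegral_congr_fun measurableSet_Ioi h, restrict_Ioi_eq_restrict_Ici,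
    setLIntegral_indicator measurableSet_Ici, inter_eq_left.2 (Ici_subset_Ici.2 hz),
    ← restrict_Ioi_eq_restrict_Ici, setLIntegral_Ioi_exp_neg_mul one_pos]
  simp

instance isProbabilityMeasure_doubleExponential : IsProbabilityMeasure doubleExponential := by
  refine ⟨?_⟩
  have := doubleExponential_le_abs le_rfl
  simpa using this

instance nullSingletonClass_doubleExponential : NullSingletonClass doubleExponential :=
  ⟨fun a => withDensity_absolutelyContinuous _ _ (measure_singleton a)⟩

theorem tail_doubleExponential {z : ℝ} (hz : 0 ≤ z) : tail doubleExponential z = Real.exp (-z) := by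
  rw [tail, measureReal_def, doubleExponential_le_abs hz, ENNReal.toReal_ofReal (Real.exp_pos _).le]

theorem lintegral_exp_doubleExponential (ξ : ℝ) :
    ∫⁻ z, ENNReal.ofReal (Real.exp (ξ * z)) ∂doubleExponential
      = if ξ ^ 2 < 1 then ENNReal.ofReal (1 / (1 - ξ ^ 2)) else ⊤ := by
  have hsplit : ∫⁻ z, ENNReal.ofReal (Real.exp (ξ * z)) ∂doubleExponential
      = ENNReal.ofReal (1 / 2) * ((∫⁻ t in Ioi 0, ENNReal.ofReal (Real.exp (-(1 - ξ) * t)))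
        + ∫⁻ t in Ioi 0, ENNReal.ofReal (Real.exp (-(1 + ξ) * t))) := by
    rw [lintegral_doubleExponential (by fun_prop), ← lintegral_add_left (by fun_prop),
      ← lintegral_const_mul' _ _ ENNReal.ofReal_ne_top]
    refine lintegral_congr fun t => ?_
    rw [ENNReal.ofReal_mul (by norm_num), mul_assoc, mul_add, ← ENNReal.ofReal_mul (by positivity),
      ← ENNReal.ofReal_mul (by positivity), ← Real.exp_add, ← Real.exp_add]
    ring_nf
  have htop : ∀ a : ℝ, a ≤ 0 → ∫⁻ t in Ioi 0, ENNReal.ofReal (Real.exp (-a * t)) = ⊤ := by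
    intro a ha
    refine top_le_iff.1 ?_
    calc (⊤ : ℝ≥0∞) = ∫⁻ t in Ioi (0 : ℝ), 1 := by simp
      _ ≤ _ := by
        refine setLIntegral_mono' measurableSet_Ioi fun t ht => ?_
        rw [← ENNReal.ofReal_one]
        refine ENNReal.ofReal_le_ofReal (Real.one_le_exp ?_)
        have : 0 < t := ht
        nlinarith
  have h2 : ENNReal.ofReal (1 / 2) ≠ 0 := by simp
  rw [hsplit]
  split_ifs with h
  · have h3 : 0 < 1 - ξ := by nlinarith
    have h4 : 0 < 1 + ξ := by nlinarith
    rw [setLIntegral_Ioi_exp_neg_mul h3, setLIntegral_Ioi_exp_neg_mul h4, ← ENNReal.ofReal_add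
      (by positivity) (by positivity), ← ENNReal.ofReal_mul (by norm_num)]
    congr 1
    have h5 : 1 - ξ ^ 2 = (1 - ξ) * (1 + ξ) := by ring
    rw [h5]
    simp
    field_simp
    ring
  · have : 1 - ξ ≤ 0 ∨ 1 + ξ ≤ 0 := by
      by_contra! hcon
      apply h
      nlinarith
    rcases this with h3 | h3
    · rw [htop _ h3, top_add, ENNReal.mul_top h2]
    · rw [htop _ h3, add_top, ENNReal.mul_top h2]

theorem logLaplace_doubleExponential (ξ : ℝ) :
    logLaplace doubleExponential ξ
      = if ξ ^ 2 < 1 then ((-Real.log (1 - ξ ^ 2) : ℝ) : EReal) else ⊤ := by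
  have h := lintegral_exp_doubleExponential ξ
  have e : ∫⁻ z, ENNReal.ofReal (Real.exp (inner ℝ ξ z)) ∂doubleExponential
      = ∫⁻ z, ENNReal.ofReal (Real.exp (ξ * z)) ∂doubleExponential := by
    simp [mul_comm]
  rw [logLaplace, e, h]
  split_ifs with h1
  · have : 0 < 1 - ξ ^ 2 := by linarith
    rw [ENNReal.log_ofReal_of_pos (by positivity), one_div, Real.log_inv]
  · simp

theorem cramer_doubleExponential (y : ℝ) : cramer doubleExponential y = (expRate y : EReal) := by
  refine le_antisymm (iSup_le fun ξ => ?_) ?_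
  · rw [logLaplace_doubleExponential]
    split_ifs with h
    · rw [← EReal.coe_sub, EReal.coe_le_coe_iff]
      have := mul_add_log_le_expRate y h
      simp
      linarith
    · simp
  · refine le_trans (le_of_eq ?_) (le_iSup _ (expTilt y))
    rw [logLaplace_doubleExponential, if_pos (expTilt_sq_lt_one y), ← EReal.coe_sub,
      ← mul_expTilt_add_log]
    simp [mul_comm]

theorem cExp_eq_lintegral :
    cExp = ∫⁻ y, ENNReal.ofReal (Real.exp (-expRate y)) ∂doubleExponential := by
  rw [cExp, expNegCramer]
  refine lintegral_congr fun y => ?_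
  rw [cramer_doubleExponential, ← EReal.coe_neg, EReal.exp_coe]

theorem continuous_expRate : Continuous expRate := by
  unfold expRate
  refine Continuous.sub (by fun_prop) (Continuous.log (by fun_prop) fun y => ?_)
  positivity

theorem expRate_abs (y : ℝ) : expRate |y| = expRate y := by
  simp [expRate]

/-- The expectation of `exp (-expRate)` at the point of the half line with the same tail is the same
for all atomless laws. -/
theorem lintegral_exp_neg_expRate_tail (ν : Measure ℝ) [IsProbabilityMeasure ν]
    [NullSingletonClass ν] :
    ∫⁻ x, ENNReal.ofReal (Real.exp (-expRate (-Real.log (tail ν |x|)))) ∂ν = cExp := by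
  have hH : Measurable fun u : ℝ => ENNReal.ofReal (Real.exp (-expRate (-Real.log u))) := by
    have := continuous_expRate.measurable
    fun_prop
  have key : ∀ (ρ : Measure ℝ) [IsProbabilityMeasure ρ] [NullSingletonClass ρ],
      ∫⁻ x, ENNReal.ofReal (Real.exp (-expRate (-Real.log (tail ρ |x|)))) ∂ρ
        = ∫⁻ u in Icc 0 1, ENNReal.ofReal (Real.exp (-expRate (-Real.log u))) := by
    intro ρ _ _
    rw [← map_tail_abs ρ, lintegral_map hH (measurable_tail_abs ρ)]
  rw [key ν, ← key doubleExponential, cExp_eq_lintegral]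
  refine lintegral_congr fun y => ?_
  rw [tail_doubleExponential (abs_nonneg y), Real.log_exp, neg_neg, expRate_abs]

/-! ### Numerical enclosure of the constant -/

theorem exp_neg_expRate (y : ℝ) :
    Real.exp (-expRate y) = Real.exp (1 - √(1 + y ^ 2)) * ((1 + √(1 + y ^ 2)) / 2) := by
  have : 0 < (1 + √(1 + y ^ 2)) / 2 := by positivity
  rw [expRate, show -(√(1 + y ^ 2) - 1 - Real.log ((1 + √(1 + y ^ 2)) / 2))
    = (1 - √(1 + y ^ 2)) + Real.log ((1 + √(1 + y ^ 2)) / 2) by ring, Real.exp_add,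
    Real.exp_log this]

theorem cExp_eq_setLIntegral_Ioi_zero :
    cExp = ∫⁻ t in Ioi 0, ENNReal.ofReal (Real.exp (-t) * Real.exp (-expRate t)) := by
  have hc := continuous_expRate.measurable
  rw [cExp_eq_lintegral, lintegral_doubleExponential (by fun_prop)]
  refine lintegral_congr fun t => ?_
  have e : expRate (-t) = expRate t := by simp [expRate]
  rw [e, ← ENNReal.ofReal_add (Real.exp_pos _).le (Real.exp_pos _).le,
    ← ENNReal.ofReal_mul (by positivity)]
  congr 1
  ring

/-- The substitution `t = (w - 1/w) / 2` turns `cExp` into an exponential integral of a Laurent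
polynomial. -/
theorem cExp_eq_setLIntegral_Ioi_one :
    cExp = ∫⁻ w in Ioi 1, ENNReal.ofReal
      (Real.exp (1 - w) * ((w + 2 + 2 / w + 2 / w ^ 2 + 1 / w ^ 3) / 8)) := by
  -- Hyperbolic parametrisation t = sinh θ with w = e^θ: the square root becomes (w + 1/w)/2 and the
  -- total exponent becomes 1 - w.
  set f : ℝ → ℝ := fun w => (w - w⁻¹) / 2 with hf
  have hd : ∀ w ∈ Ioi (1 : ℝ), HasDerivWithinAt f ((1 + (w ^ 2)⁻¹) / 2) (Ioi 1) w := by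
    intro w hw
    have hw0 : w ≠ 0 := (zero_lt_one.trans hw).ne'
    have := ((hasDerivAt_id w).sub (hasDerivAt_inv hw0)).div_const 2
    refine (HasDerivAt.congr_deriv this ?_).hasDerivWithinAt
    ring
  have hmono : StrictMonoOn f (Ioi 0) := by
    intro a ha b hb hab
    have : b⁻¹ < a⁻¹ := inv_strictAnti₀ ha hab
    simp only [hf]
    linarith
  have himg : f '' Ioi 1 = Ioi 0 := by
    ext t
    simp only [mem_image, mem_Ioi]
    constructor
    · rintro ⟨w, hw, rfl⟩
      have : w⁻¹ < 1 := inv_lt_one_of_one_lt₀ hw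
      simp only [hf]
      linarith
    · intro ht
      have h : √(1 + t ^ 2) ^ 2 = 1 + t ^ 2 := Real.sq_sqrt (by positivity)
      have h1 : 1 ≤ √(1 + t ^ 2) := Real.one_le_sqrt.2 (by nlinarith)
      refine ⟨t + √(1 + t ^ 2), by linarith, ?_⟩
      have hinv : (t + √(1 + t ^ 2))⁻¹ = √(1 + t ^ 2) - t :=
        inv_eq_of_mul_eq_one_right (by linear_combination h)
      simp only [hf, hinv]
      ring
  rw [cExp_eq_setLIntegral_Ioi_zero, ← himg, lintegral_image_eq_lintegral_abs_deriv_mul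
    measurableSet_Ioi hd (hmono.injOn.mono (Ioi_subset_Ioi zero_le_one))]
  refine setLIntegral_congr_fun measurableSet_Ioi fun w hw => ?_
  have hw0 : 0 < w := zero_lt_one.trans hw
  have hsqrt : √(1 + f w ^ 2) = (w + w⁻¹) / 2 := by
    rw [show 1 + f w ^ 2 = ((w + w⁻¹) / 2) ^ 2 by simp only [hf]; field_simp; ring]
    exact Real.sqrt_sq (by positivity)
  rw [exp_neg_expRate, hsqrt, abs_of_pos (by positivity), ← ENNReal.ofReal_mul (by positivity),
    ← mul_assoc (Real.exp _), ← Real.exp_add,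
    show -f w + (1 - (w + w⁻¹) / 2) = 1 - w by simp only [hf]; ring]
  congr 1
  field_simp
  ring

/-- The integrand is the derivative of -e^{1-w} r(w); the linear growth bound kills the boundary
term at infinity. -/
theorem setLIntegral_Ioi_one_exp_mul_sub_deriv {r r' : ℝ → ℝ} {C : ℝ}
    (hr : ∀ w ∈ Ici (1 : ℝ), HasDerivAt r (r' w) w) (hpos : ∀ w ∈ Ioi (1 : ℝ), 0 ≤ r w - r' w)
    (hC : ∀ w ∈ Ici (1 : ℝ), |r w| ≤ C * w) :
    ∫⁻ w in Ioi 1, ENNReal.ofReal (Real.exp (1 - w) * (r w - r' w)) = ENNReal.ofReal (r 1) := by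
  have hd : ∀ w ∈ Ici (1 : ℝ), HasDerivAt (fun w => -(Real.exp (1 - w) * r w))
      (Real.exp (1 - w) * (r w - r' w)) w := by
    intro w hw
    have h1 : HasDerivAt (fun w : ℝ => 1 - w) (-1) w := by
      simpa using (hasDerivAt_id w).const_sub 1
    refine HasDerivAt.congr_deriv (h1.exp.mul (hr w hw)).neg ?_
    ring
  have hp : ∀ w ∈ Ioi (1 : ℝ), 0 ≤ Real.exp (1 - w) * (r w - r' w) := fun w hw =>
    mul_nonneg (Real.exp_pos _).le (hpos w hw)
  have hlim : Tendsto (fun w => -(Real.exp (1 - w) * r w)) atTop (𝓝 0) := by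
    have h1 := (Real.tendsto_pow_mul_exp_neg_atTop_nhds_zero 1).const_mul (C * Real.exp 1)
    rw [mul_zero] at h1
    refine squeeze_zero_norm' ?_ h1
    filter_upwards [eventually_ge_atTop 1] with w hw
    rw [norm_neg, norm_mul, Real.norm_eq_abs, Real.norm_eq_abs, abs_of_pos (Real.exp_pos _),
      sub_eq_add_neg, Real.exp_add, pow_one]
    have := mul_le_mul_of_nonneg_left (hC w hw)
      (mul_pos (Real.exp_pos 1) (Real.exp_pos (-w))).le
    linarith
  rw [← ofReal_integral_eq_lintegral_ofReal, integral_Ioi_of_hasDerivAt_of_nonneg' hd hp hlim]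
  · simp
  · exact integrableOn_Ioi_deriv_of_nonneg' hd hp hlim
  · exact (ae_restrict_iff' measurableSet_Ioi).2 (ae_of_all _ hp)

/-- A bound for `cExp` from an approximate antiderivative `p / q` of `exp (1 - w) / w`. -/
theorem setLIntegral_Ioi_one_of_rational {p q p' q' : ℝ → ℝ}
    (hp : ∀ w, HasDerivAt p (p' w) w) (hq : ∀ w, HasDerivAt q (q' w) w)
    (hq0 : ∀ w ∈ Ici (1 : ℝ), 0 < q w) (hp0 : ∀ w ∈ Ici (1 : ℝ), 0 ≤ p w)
    (hpq : ∀ w ∈ Ici (1 : ℝ), p w ≤ q w) {e : ℝ → ℝ}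
    (he : ∀ w ∈ Ici (1 : ℝ), p w / q w - (p' w * q w - p w * q' w) / q w ^ 2 = 1 / w - e w)
    (he1 : ∀ w ∈ Ici (1 : ℝ), e w ≤ 1 / w) :
    ∫⁻ w in Ioi 1, ENNReal.ofReal
      (Real.exp (1 - w) * ((w + 2 + 2 / w + 2 / w ^ 2 + 1 / w ^ 3) / 8 - e w / 16))
      = ENNReal.ofReal (3 / 4 + p 1 / q 1 / 16) := by
  -- Integration by parts removes every term of the Laurent polynomial except a multiple of 1/w,
  -- whose exact contribution e^w E₁(w)/16 is replaced by p/(16q). The defect e measures the error,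
  -- and its sign decides the direction of the bound.
  set r : ℝ → ℝ := fun w => (w + 3) / 8 + 3 / 16 * w⁻¹ + 1 / 16 * (w⁻¹) ^ 2 + 1 / 16 * (p w / q w)
  set r' : ℝ → ℝ := fun w => 1 / 8 + 3 / 16 * (-(w ^ 2)⁻¹) + 1 / 16 * (2 * w⁻¹ * (-(w ^ 2)⁻¹))
    + 1 / 16 * ((p' w * q w - p w * q' w) / q w ^ 2)
  have hsub : ∀ w ∈ Ici (1 : ℝ), r w - r' w
      = (w + 2 + 2 / w + 2 / w ^ 2 + 1 / w ^ 3) / 8 - e w / 16 := by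
    intro w hw
    have hw0 : w ≠ 0 := (zero_lt_one.trans_le hw).ne'
    have h := he w hw
    have h2 : p w / q w = 1 / w - e w + (p' w * q w - p w * q' w) / q w ^ 2 := by linarith
    simp only [r, r', h2]
    field_simp
    ring
  have hd : ∀ w ∈ Ici (1 : ℝ), HasDerivAt r (r' w) w := by
    intro w hw
    have hw0 : w ≠ 0 := (zero_lt_one.trans_le hw).ne'
    have h1 : HasDerivAt (fun w : ℝ => (w + 3) / 8) (1 / 8) w :=
      ((hasDerivAt_id w).add_const 3).div_const 8
    have h2 := hasDerivAt_inv hw0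
    have h3 : HasDerivAt (fun w : ℝ => (w⁻¹) ^ 2) (2 * w⁻¹ * (-(w ^ 2)⁻¹)) w := by
      simpa using h2.fun_pow 2
    exact ((h1.add (h2.const_mul _)).add (h3.const_mul _)).add
      (((hp w).div (hq w) (hq0 w hw).ne').const_mul _)
  have hpos : ∀ w ∈ Ioi (1 : ℝ), 0 ≤ r w - r' w := by
    intro w hw
    have hw1 : w ∈ Ici (1 : ℝ) := le_of_lt (mem_Ioi.1 hw)
    have hw0 : 0 < w := zero_lt_one.trans hw
    rw [hsub w hw1]
    have h1 := he1 w hw1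
    have h2 : 0 ≤ 2 / w ^ 2 := by positivity
    have h3 : 0 ≤ 1 / w ^ 3 := by positivity
    have h4 : 2 / w = 2 * (1 / w) := by ring
    have h5 : 0 ≤ 1 / w := by positivity
    linarith
  have hC : ∀ w ∈ Ici (1 : ℝ), |r w| ≤ 1 * w := by
    intro w hw
    have hw1 : 1 ≤ w := hw
    have hw0 : 0 < w := by linarith
    have h1 : p w / q w ≤ 1 := (div_le_one (hq0 w hw)).2 (hpq w hw)
    have h2 : 0 ≤ p w / q w := div_nonneg (hp0 w hw) (hq0 w hw).le
    have h3 : w⁻¹ ≤ 1 := inv_le_one_of_one_le₀ hw1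
    have h4 : 0 < w⁻¹ := by positivity
    have h5 : (w⁻¹) ^ 2 ≤ 1 := pow_le_one₀ h4.le h3
    have h6 : 0 ≤ (w⁻¹) ^ 2 := by positivity
    simp only [r]
    rw [abs_of_nonneg (by positivity)]
    linarith
  rw [← setLIntegral_congr_fun measurableSet_Ioi (f := fun w => ENNReal.ofReal
    (Real.exp (1 - w) * (r w - r' w)))
    (fun w hw => by simp only [hsub w (le_of_lt (mem_Ioi.1 hw))]),
    setLIntegral_Ioi_one_exp_mul_sub_deriv hd hpos hC]
  congr 1
  simp only [r]
  norm_num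
  ring

/-- Here p/q is a convergent of the continued fraction of e^w E₁(w) from below, with q(w) =
4!·L₄(-w) for the Laguerre polynomial L₄. The defect is positive, and p(1)/q(1) = 124/209. -/
theorem le_cExp : ENNReal.ofReal 0.787 ≤ cExp := by
  have h := setLIntegral_Ioi_one_of_rational
    (p := fun w => w ^ 3 + 15 * w ^ 2 + 58 * w + 50) (p' := fun w => 3 * w ^ 2 + 30 * w + 58)
    (q := fun w => w ^ 4 + 16 * w ^ 3 + 72 * w ^ 2 + 96 * w + 24)
    (q' := fun w => 4 * w ^ 3 + 48 * w ^ 2 + 144 * w + 96)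
    (e := fun w => 576 / (w * (w ^ 4 + 16 * w ^ 3 + 72 * w ^ 2 + 96 * w + 24) ^ 2))
    (fun w => by
      have h1 := hasDerivAt_id w
      refine HasDerivAt.congr_deriv ((((h1.fun_pow 3).add ((h1.fun_pow 2).const_mul 15)).add
        (h1.const_mul 58)).add_const 50) ?_
      simp
      ring)
    (fun w => by
      have h1 := hasDerivAt_id w
      refine HasDerivAt.congr_deriv (((((h1.fun_pow 4).add ((h1.fun_pow 3).const_mul 16)).add
        ((h1.fun_pow 2).const_mul 72)).add (h1.const_mul 96)).add_const 24) ?_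
      simp
      ring)
    (fun w hw => by
      have : 0 < w := zero_lt_one.trans_le hw
      positivity)
    (fun w hw => by
      have : 0 < w := zero_lt_one.trans_le hw
      positivity)
    (fun w hw => by
      have h1 : 1 ≤ w := hw
      nlinarith [pow_nonneg (zero_le_one.trans h1) 3, pow_nonneg (zero_le_one.trans h1) 4])
    (fun w hw => by
      have : 0 < w := zero_lt_one.trans_le hw
      field_simp
      ring)
    (fun w hw => by
      have h1 : 1 ≤ w := hw
      have h0 : 0 < w := by linarith
      have hq : 24 ≤ w ^ 4 + 16 * w ^ 3 + 72 * w ^ 2 + 96 * w + 24 := by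
        have : 0 ≤ w ^ 4 + 16 * w ^ 3 + 72 * w ^ 2 + 96 * w := by positivity
        linarith
      rw [div_le_div_iff₀ (by positivity) h0]
      nlinarith [mul_le_mul_of_nonneg_left (pow_le_pow_left₀ (by norm_num) hq 2) h0.le])
  rw [cExp_eq_setLIntegral_Ioi_one]
  calc ENNReal.ofReal 0.787 ≤ _ := ENNReal.ofReal_le_ofReal (by norm_num)
    _ = _ := h.symm
    _ ≤ _ := by
      refine setLIntegral_mono' measurableSet_Ioi fun w hw => ENNReal.ofReal_le_ofReal ?_
      have : 0 < w := zero_lt_one.trans hw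
      gcongr
      exact sub_le_self _ (by positivity)

/-- The neighbouring convergent, from above, with q(w) = 3!·w·L₃⁽¹⁾(-w) for the associated Laguerre
polynomial. The defect is negative, and p(1)/q(1) = 44/73 leaves room for strictness. -/
theorem cExp_lt : cExp < ENNReal.ofReal 0.788 := by
  have h := setLIntegral_Ioi_one_of_rational
    (p := fun w => w ^ 3 + 11 * w ^ 2 + 26 * w + 6) (p' := fun w => 3 * w ^ 2 + 22 * w + 26)
    (q := fun w => w ^ 4 + 12 * w ^ 3 + 36 * w ^ 2 + 24 * w)
    (q' := fun w => 4 * w ^ 3 + 36 * w ^ 2 + 72 * w + 24)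
    (e := fun w => -(144 / (w ^ 4 + 12 * w ^ 3 + 36 * w ^ 2 + 24 * w) ^ 2))
    (fun w => by
      have h1 := hasDerivAt_id w
      refine HasDerivAt.congr_deriv ((((h1.fun_pow 3).add ((h1.fun_pow 2).const_mul 11)).add
        (h1.const_mul 26)).add_const 6) ?_
      simp
      ring)
    (fun w => by
      have h1 := hasDerivAt_id w
      refine HasDerivAt.congr_deriv ((((h1.fun_pow 4).add ((h1.fun_pow 3).const_mul 12)).add
        ((h1.fun_pow 2).const_mul 36)).add (h1.const_mul 24)) ?_
      simp
      ring)
    (fun w hw => by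
      have : 0 < w := zero_lt_one.trans_le hw
      positivity)
    (fun w hw => by
      have : 0 < w := zero_lt_one.trans_le hw
      positivity)
    (fun w hw => by
      have h1 : 1 ≤ w := hw
      nlinarith [pow_nonneg (zero_le_one.trans h1) 3, pow_nonneg (zero_le_one.trans h1) 4])
    (fun w hw => by
      have : 0 < w := zero_lt_one.trans_le hw
      field_simp
      ring)
    (fun w hw => by
      have h0 : 0 < w := zero_lt_one.trans_le hw
      have h1 : 0 ≤ 144 / (w ^ 4 + 12 * w ^ 3 + 36 * w ^ 2 + 24 * w) ^ 2 := by positivity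
      have h2 : 0 ≤ 1 / w := by positivity
      linarith)
  rw [cExp_eq_setLIntegral_Ioi_one]
  calc _ ≤ _ := by
        refine setLIntegral_mono' measurableSet_Ioi fun w hw => ENNReal.ofReal_le_ofReal ?_
        have : 0 < w := zero_lt_one.trans hw
        refine mul_le_mul_of_nonneg_left ?_ (Real.exp_pos _).le
        refine le_sub_self_iff _ |>.2 ?_
        rw [neg_div]
        exact neg_nonpos.2 (by positivity)
    _ = _ := h
    _ < _ := (ENNReal.ofReal_lt_ofReal_iff (by norm_num)).2 (by norm_num)

/-! ### Passage to independent components -/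

theorem le_cramer_of_lintegral_exp_le {E : Type*} [NormedAddCommGroup E] [InnerProductSpace ℝ E]
    [MeasurableSpace E] {μ : Measure E} {x ξ : E} {a : ℝ}
    (h : ∫⁻ z, ENNReal.ofReal (Real.exp (inner ℝ ξ z)) ∂μ
      ≤ ENNReal.ofReal (Real.exp (inner ℝ x ξ - a))) : (a : EReal) ≤ cramer μ x := by
  refine le_trans ?_ (le_iSup _ ξ)
  have h1 : logLaplace μ ξ ≤ ((inner ℝ x ξ - a : ℝ) : EReal) := by
    refine (ENNReal.log_le_log h).trans_eq ?_
    rw [ENNReal.log_ofReal_of_pos (Real.exp_pos _), Real.log_exp]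
  calc (a : EReal) = ((inner ℝ x ξ : ℝ) : EReal) - ((inner ℝ x ξ - a : ℝ) : EReal) := by
        rw [← EReal.coe_sub]; simp
    _ ≤ _ := EReal.sub_le_sub le_rfl h1

theorem lintegral_exp_inner_eq_prod {Ω : Type*} [MeasurableSpace Ω] {P : Measure Ω} {n : ℕ}
    {X : Ω → EuclideanSpace ℝ (Fin n)} (hX : Measurable X)
    (hindep : iIndepFun (fun (i : Fin n) (ω : Ω) => X ω i) P) (ξ : EuclideanSpace ℝ (Fin n)) :
    ∫⁻ z, ENNReal.ofReal (Real.exp (inner ℝ ξ z)) ∂(P.map X)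
      = ∏ i, ∫⁻ z, ENNReal.ofReal (Real.exp (ξ i * z)) ∂(P.map fun ω => X ω i) := by
  have hXi : ∀ i, Measurable fun ω => X ω i := fun i => by fun_prop
  have hg : ∀ i, Measurable fun z : ℝ => ENNReal.ofReal (Real.exp (ξ i * z)) := fun i => by fun_prop
  rw [lintegral_map (by fun_prop) hX]
  have h := lintegral_prod_eq_prod_lintegral_of_indepFun Finset.univ
    (fun i ω => ENNReal.ofReal (Real.exp (ξ i * X ω i))) (hindep.comp _ hg)
    (fun i => (hg i).comp (hXi i))
  simp_rw [lintegral_map (hg _) (hXi _)]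
  rw [← h]
  refine lintegral_congr fun ω => ?_
  rw [← ENNReal.ofReal_prod_of_nonneg (fun i _ => (Real.exp_pos _).le), ← Real.exp_sum,
    PiLp.inner_apply]
  simp [mul_comm]

theorem expNegCramer_map_le {Ω : Type*} [MeasurableSpace Ω] {P : Measure Ω}
    [IsProbabilityMeasure P] {n : ℕ} {X : Ω → EuclideanSpace ℝ (Fin n)} (hX : Measurable X)
    (hindep : iIndepFun (fun (i : Fin n) (ω : Ω) => X ω i) P)
    (hsymm : ∀ i, P.map (fun ω => -(X ω i)) = P.map (fun ω => X ω i))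
    (hlc : ∀ i, IsLogConcave (P.map (fun ω => X ω i)))
    (hnondeg : ∀ i, ∀ a : ℝ, P.map (fun ω => X ω i) {a} < 1) :
    expNegCramer (P.map X) ≤ cExp ^ n := by
  have hXi : ∀ i, Measurable fun ω => X ω i := fun i => by fun_prop
  set ν : Fin n → Measure ℝ := fun i => P.map fun ω => X ω i with hν
  have hprob : ∀ i, IsProbabilityMeasure (ν i) := fun i =>
    Measure.isProbabilityMeasure_map (hXi i).aemeasurable
  have hs : ∀ i, (ν i).map (fun x => -x) = ν i := fun i => by
    rw [hν, Measure.map_map measurable_neg (hXi i)]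
    exact hsymm i
  have hatom : ∀ i, NullSingletonClass (ν i) := fun i =>
    noAtoms_of_isLogConcave (hs i) (hlc i) (hnondeg i)
  set L : Fin n → ℝ → ℝ := fun i x => expRate (-Real.log (tail (ν i) |x|)) with hL
  have hLm : ∀ i, Measurable (L i) := fun i =>
    continuous_expRate.measurable.comp
      (measurable_tail_abs (ν i)).log.neg
  have hGm : ∀ i, Measurable fun x => ENNReal.ofReal (Real.exp (-L i x)) := fun i => by
    have := hLm i
    fun_prop
  have hgood : ∀ i, ∀ᵐ x ∂(P.map X), ∃ ξ : ℝ,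
      ∫⁻ z, ENNReal.ofReal (Real.exp (ξ * z)) ∂(ν i)
        ≤ ENNReal.ofReal (Real.exp (x i * ξ - L i (x i))) := by
    intro i
    have hev : Measurable fun x : EuclideanSpace ℝ (Fin n) => x i := by fun_prop
    have hmap : (P.map X).map (fun x => x i) = ν i := by
      rw [Measure.map_map hev hX]
      rfl
    have h1 : ∀ᵐ t ∂(ν i), ∃ ξ : ℝ, ∫⁻ z, ENNReal.ofReal (Real.exp (ξ * z)) ∂(ν i)
        ≤ ENNReal.ofReal (Real.exp (t * ξ - L i t)) := by
      have hne : ∀ᵐ t ∂(ν i), t ≠ 0 := by simp [ae_iff]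
      filter_upwards [hne, ae_tail_mem_Ioo (ν i)] with t ht0 ht
      exact exists_lintegral_exp_le (hs i) (hlc i) ht0 ht.1 ht.2
    have h2 : ∀ᵐ t ∂((P.map X).map fun x => x i), ∃ ξ : ℝ,
        ∫⁻ z, ENNReal.ofReal (Real.exp (ξ * z)) ∂(ν i)
          ≤ ENNReal.ofReal (Real.exp (t * ξ - L i t)) := by
      rw [hmap]
      exact h1
    exact ae_of_ae_map hev.aemeasurable h2
  have hprodm : Measurable fun x : EuclideanSpace ℝ (Fin n) =>
      ∏ i, ENNReal.ofReal (Real.exp (-L i (x i))) :=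
    Finset.measurable_prod _ fun i _ => (hGm i).comp (by fun_prop)
  calc expNegCramer (P.map X)
      ≤ ∫⁻ x, ∏ i, ENNReal.ofReal (Real.exp (-L i (x i))) ∂(P.map X) := by
        refine lintegral_mono_ae ?_
        filter_upwards [ae_all_iff.2 hgood] with x hx
        choose ξ hξ using hx
        have hle : ((∑ i, L i (x i) : ℝ) : EReal) ≤ cramer (P.map X) x := by
          -- The one-dimensional tilts at the coordinates of x, assembled into a single vector, test
          -- the supremum.
          refine le_cramer_of_lintegral_exp_le (ξ := WithLp.toLp 2 ξ) ?_
          rw [lintegral_exp_inner_eq_prod hX hindep]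
          refine (Finset.prod_le_prod' fun i _ => hξ i).trans_eq ?_
          rw [← ENNReal.ofReal_prod_of_nonneg (fun i _ => (Real.exp_pos _).le), ← Real.exp_sum,
            Finset.sum_sub_distrib, PiLp.inner_apply]
          simp [mul_comm]
        rw [← ENNReal.ofReal_prod_of_nonneg (fun i _ => (Real.exp_pos _).le), ← Real.exp_sum,
          Finset.sum_neg_distrib, ← EReal.exp_coe, EReal.coe_neg]
        exact EReal.exp_monotone (EReal.neg_le_neg_iff.2 hle)
    _ = ∏ i, ∫⁻ x, ENNReal.ofReal (Real.exp (-L i x)) ∂(ν i) := by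
        rw [lintegral_map hprodm hX, lintegral_prod_eq_prod_lintegral_of_indepFun Finset.univ
          (fun i ω => ENNReal.ofReal (Real.exp (-L i (X ω i)))) (hindep.comp _ hGm)
          (fun i => (hGm i).comp (hXi i))]
        simp_rw [hν, lintegral_map (hGm _) (hXi _)]
    _ = cExp ^ n := by
        simp only [hL, lintegral_exp_neg_expRate_tail]
        simp

end OneShot

end

theorem theorem1p3 {Ω : Type*} [MeasurableSpace Ω] (P : Measure Ω) [IsProbabilityMeasure P]
    (n : ℕ) (X : Ω → EuclideanSpace ℝ (Fin n)) (hX : Measurable X)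
    (hindep : iIndepFun (fun (i : Fin n) (ω : Ω) => X ω i) P)
    -- each component is symmetric about the origin
    (hsymm : ∀ i, P.map (fun ω => -(X ω i)) = P.map (fun ω => X ω i))
    (hlc : ∀ i, OneShot.IsLogConcave (P.map (fun ω => X ω i)))
    -- no component is concentrated at a single point
    (hnondeg : ∀ i, ∀ a : ℝ, P.map (fun ω => X ω i) {a} < 1) :
    OneShot.expNegCramer (P.map X) ≤ OneShot.cExp ^ n ∧
    -- the decimal expansion of the constant starts with 0.787
    ENNReal.ofReal 0.787 ≤ OneShot.cExp ∧ OneShot.cExp < ENNReal.ofReal 0.788 := by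
  exact ⟨OneShot.expNegCramer_map_le hX hindep hsymm hlc hnondeg, OneShot.le_cExp, OneShot.cExp_lt⟩
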